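/- \textbf{The algorithm.} Let $G=(V,E)$ be a graph with $n$ nodes and maximum degree at most $\Delta$, where $\Delta\ge 2$ is an integer, let $\alpha\in(0,1)$, and let $C,c$ be real constants. Write $\log=\log_2$, $R=\lceil \alpha\sqrt{\log\Delta}/10\rceil$, $k=\lceil 12\,C\log\Delta\rceil$ and $T=\lceil c\log\Delta\rceil$. Initially all nodes are present and $p_0(v)=1/2$ for every $v$. Iterations $t=1,\dots,T$ are grouped into consecutive phases of $R$ iterations each (the last phase may be shorter). For every node $v$ and every $t$, there are $k+1$ random numbers $r^1_{t-1}(v),\dots,r^k_{t-1}(v),r^m_t(v)$, all independent and uniform in $[0,1]$. In iteration $t$, with $N(v)$ the set of neighbors of $v$ that have not been removed, every remaining node $v$ does the following. (a) Let $\hat d_{t-1}(v)$ be the median over $j=1,\dots,k$ of the numbers $|\{u\in N(v): r^j_{t-1}(u)<p_{t-1}(u)\}|$ (the mean of the two middle values if $k$ is even). If $t$ is the first iteration of a phase and $\hat d_{t-1}(v)\ge 2^{\alpha\sqrt{\log\Delta}/5}$, then $v$ stalls for this whole phase. (b) Set $p_t(v)=p_{t-1}(v)/2$ if $\hat d_{t-1}(v)\ge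 2$ or $v$ is stalling, and $p_t(v)=\min\{2p_{t-1}(v),1/2\}$ otherwise. (c) If $v$ is not stalling, it is marked if and only if $r^m_t(v)<p_t(v)$. A marked node none of whose neighbors is marked joins the MIS, and is removed together with all its neighbors. Let $B$ be the set of nodes that remain after $T$ iterations. \textbf{Theorem.} There is an absolute constant $K$ such that for every $\alpha\in(0,1)$, every sufficiently large $C$ (depending on $\alpha$) and every sufficiently large $c$ (depending on $\alpha$ and $C$), the following holds for every integer $\Delta\ge 2$ and every graph $G$ with $n$ nodes and maximum degree at most $\Delta$. For each node $v$, with probability at least $1-1/\Delta^{C}$, $v$ or a neighbor of $v$ joins the MIS during the $T$ iterations. This guarantee holds independently of the randomness outside the $2$-hop neighborhood of $v$: for every fixed choice of the random numbers of all nodes at distance more than $2$ from $v$, the probability of this event, over the random numbers of the nodes at distance at most $2$ from $v$, is at least $1-1/\Delta^{C}$. Furthermore, if $n\ge 1$, then with probability at least $1-1/n^{10}$ all of the following hold: (1) each connected component of the subgraph of $G$ induced by $B$ has at most $K\cdot \Delta^4\log_\Delta n$ nodes; (2) $|B|\le n/\Delta^{10}$; (3) if $\Delta>n^{\alpha/4}$,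 then $B=\emptyset$. -/

import Mathlib

open MeasureTheory

namespace SparseMIS

/-- The fresh random numbers of one node in one iteration: `k` numbers for the `k` repetitions of
the sampling, and one number for the marking. -/
abbrev NodeCoins (k : ℕ) : Type := (Fin k → unitInterval) × unitInterval

/-- The randomness of a `T`-iteration execution. Its canonical measure `volume` is the product of
the uniform measures on `[0, 1]`: all the numbers are independent and uniform. -/
abbrev Coins (V : Type*) (T k : ℕ) : Type _ := Fin T → V → NodeCoins k

/-- The median of `k` numbers: with `x₀ ≤ ⋯ ≤ xₖ₋₁` the sorted values, it is the middle one if `k`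
is odd and the mean of the two middle ones if `k` is even (and `0` if `k = 0`). -/
noncomputable def median {k : ℕ} (f : Fin k → ℕ) : ℝ :=
  if h : 0 < k then
    ((f (Tuple.sort f ⟨(k - 1) / 2, by omega⟩) : ℝ) + f (Tuple.sort f ⟨k / 2, by omega⟩)) / 2
  else 0

/-- The global state between two iterations. -/
structure State (V : Type*) where
  /-- the nodes that have not been removed -/
  active : Set V
  /-- the nodes that have joined the independent set -/
  mis : Set V
  /-- the nodes that are stalling in the current phase -/
  stalling : Set V
  /-- the marking probabilities `p_t` -/
  p : V → ℝ

/-- The state before the first iteration: all nodes are present and `p₀ = 1/2`. -/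
noncomputable def State.init (V : Type*) : State V where
  active := Set.univ
  mis := ∅
  stalling := ∅
  p := fun _ => 1 / 2

section Algorithm

variable {V : Type*} (G : SimpleGraph V) {k : ℕ}

/-- The number of remaining neighbors of `v` that are sampled in repetition `j`, where a node `u`
is sampled if its random number is smaller than `p u`. -/
noncomputable def sampleCount (s : State V) (r : V → NodeCoins k) (v : V) (j : Fin k) : ℕ :=
  {u : V | G.Adj v u ∧ u ∈ s.active ∧ (((r u).1 j : unitInterval) : ℝ) < s.p u}.ncard

/-- The estimate of the sum of `p u` over the remaining neighbors `u` of `v`: the median of the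
`k` sample counts. -/
noncomputable def estimate (s : State V) (r : V → NodeCoins k) (v : V) : ℝ :=
  median (sampleCount G s r v)

/-- The nodes that stall in the iteration with (zero-based) number `t`: it is decided in the first
iteration of each phase of `R` iterations, by comparing the estimate with the threshold `θ`, and
kept for the rest of the phase. -/
noncomputable def nextStalling (R : ℕ) (θ : ℝ) (t : ℕ) (s : State V) (r : V → NodeCoins k) :
    Set V :=
  if t % R = 0 then {v | θ ≤ estimate G s r v} else s.stalling

open Classical in
/-- Round 1 of an iteration: the new probabilities. -/
noncomputable def nextP (R : ℕ) (θ : ℝ) (t : ℕ) (s : State V) (r : V → NodeCoins k) (v : V) : ℝ :=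
  if 2 ≤ estimate G s r v ∨ v ∈ nextStalling G R θ t s r then s.p v / 2
  else min (2 * s.p v) (1 / 2)

/-- Round 2 of an iteration: the remaining nodes that do not stall mark themselves with the new
probability. -/
def marked (R : ℕ) (θ : ℝ) (t : ℕ) (s : State V) (r : V → NodeCoins k) : Set V :=
  {v | v ∈ s.active ∧ v ∉ nextStalling G R θ t s r ∧ ((r v).2 : ℝ) < nextP G R θ t s r v}

/-- The nodes that join in an iteration: the marked nodes without a marked neighbor. -/
def joining (R : ℕ) (θ : ℝ) (t : ℕ) (s : State V) (r : V → NodeCoins k) : Set V :=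
  {v | v ∈ marked G R θ t s r ∧ ∀ u, G.Adj v u → u ∉ marked G R θ t s r}

/-- One iteration, with (zero-based) number `t`: joining nodes are removed with all their
neighbors. -/
noncomputable def step (R : ℕ) (θ : ℝ) (t : ℕ) (s : State V) (r : V → NodeCoins k) : State V where
  active := {v | v ∈ s.active ∧ v ∉ joining G R θ t s r ∧
    ∀ u, G.Adj v u → u ∉ joining G R θ t s r}
  mis := s.mis ∪ joining G R θ t s r
  stalling := nextStalling G R θ t s r
  p := nextP G R θ t s r

/-- The state after `t` iterations, when the execution has `T` iterations in total. -/
noncomputable def stateAfter (R : ℕ) (θ : ℝ) {T : ℕ} (ω : Coins V T k) : ℕ → State V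
  | 0 => State.init V
  | t + 1 =>
    if h : t < T then step G R θ t (stateAfter R θ ω t) (ω ⟨t, h⟩) else stateAfter R θ ω t

/-- The length `α √(log Δ) / 10` of a phase (rounded up to an integer). -/
noncomputable def phaseLength (α : ℝ) (Δ : ℕ) : ℕ := ⌈α * √(Real.logb 2 Δ) / 10⌉₊

/-- The stalling threshold `2 ^ (α √(log Δ) / 5)`. -/
noncomputable def stallThreshold (α : ℝ) (Δ : ℕ) : ℝ := (2 : ℝ) ^ (α * √(Real.logb 2 Δ) / 5)

/-- The number `12 C log Δ` of repetitions of the sampling (rounded up to an integer). -/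
noncomputable def numRepetitions (C : ℝ) (Δ : ℕ) : ℕ := ⌈12 * C * Real.logb 2 Δ⌉₊

/-- The number `c log Δ` of iterations (rounded up to an integer). -/
noncomputable def numIterations (c : ℝ) (Δ : ℕ) : ℕ := ⌈c * Real.logb 2 Δ⌉₊

/-- The final state of the sparsified algorithm on `G`, run with parameters `α` and `Δ`. -/
noncomputable def finalState (α : ℝ) (Δ : ℕ) {T : ℕ} (ω : Coins V T k) : State V :=
  stateAfter G (phaseLength α Δ) (stallThreshold α Δ) ω T

/-- The node `v` or one of its neighbors has joined the independent set. -/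
def Decided (α : ℝ) (Δ : ℕ) {T : ℕ} (ω : Coins V T k) (v : V) : Prop :=
  v ∈ (finalState G α Δ ω).mis ∨ ∃ u, G.Adj v u ∧ u ∈ (finalState G α Δ ω).mis

/-- The set `B` of the nodes that remain at the end. -/
def remaining (α : ℝ) (Δ : ℕ) {T : ℕ} (ω : Coins V T k) : Set V :=
  (finalState G α Δ ω).active

/-- The nodes at distance at most two from `v` (including `v`). -/
def twoHop (v : V) : Set V := {u | G.edist v u ≤ 2}

open Classical in
/-- The randomness that agrees with `ω` at the nodes of the two-hop neighborhood of `v`, and with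
`η` at all the other nodes. -/
noncomputable def splice (v : V) {T : ℕ} (ω η : Coins V T k) : Coins V T k :=
  fun t u => if u ∈ twoHop G v then ω t u else η t u

end Algorithm

end SparseMIS

/-! Each node `v` carries a potential: 0 once `v` is removed, and otherwise the ε-th power of
max(500d, (3/2)^J)^4 / (2p). Here d is the sum of `p` over the remaining neighbors, p is the
probability of `v`, and the lift J counts down the iterations of a stalled phase. The potential is
at least 1 while `v` remains and at most (500Δ)^4 at the start. If each iteration shrinks it by a
constant factor in conditional expectation, then after c log Δ iterations Markov's inequality bounds
the survival probability by Δ^(-C).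

The contraction (`lintegral_nextPotential_le`) has three sources. If good nodes around `v` have
substantial total marking probability (`Golden`), one of them joins with constant probability and
the potential vanishes; otherwise the base grows at most 32-fold, and a small ε brings the average
below 1. If the neighborhood is neither golden nor misled, the base at least halves
(`pot_step_le_half`): either p is halved while the maximum drops by a factor 2/3, and 2(2/3)^4 <
1/2, or p is doubled while the maximum does not grow. Being misled by the estimates has probability
at most 21·4^(-k), which beats the worst growth 32·2^k.

The one-step bound `nextPotential` reads only the fresh coins within distance two of `v`. Hence
coins elsewhere may be frozen, and for nodes with disjoint two-hop neighborhoods the conditional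
expectations multiply. This yields `exists_volume_remaining_le`: such a set S remains entirely with
probability at most Δ^(-C|S|).

The global claims follow by union bounds (`shattering`). A large component contains many nodes at
pairwise distance at least five, visited by a chain of short steps, and there are few such chains. A
large remaining set contains a large separated subset. If n is at most a fixed power of Δ, a union
over single nodes already shows that nothing remains. -/

open scoped ENNReal

universe u

namespace SparseMIS

/-! ### The potential, and locality of one iteration. -/

section Dynamics

variable {V : Type*} (G : SimpleGraph V) {k : ℕ}

/-- The nodes whose probability is halved in an iteration. -/
def halving (R : ℕ) (θ : ℝ) (t : ℕ) (s : State V) (r : V → NodeCoins k) : Set V :=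
  {v | 2 ≤ estimate G s r v ∨ v ∈ nextStalling G R θ t s r}

/-- The largest possible probability of a node after the next iteration. -/
noncomputable def markBound (s : State V) (u : V) : ℝ := min (2 * s.p u) (1 / 2)

open Classical in
/-- The remaining neighbors of a node. -/
noncomputable def activeNbrs [Fintype V] (s : State V) (v : V) : Finset V :=
  {u | G.Adj v u ∧ u ∈ s.active}

/-- The sum of `p u` over the remaining neighbors `u` of `v`. -/
noncomputable def load [Fintype V] (s : State V) (p : V → ℝ) (v : V) : ℝ :=
  ∑ u ∈ activeNbrs G s v, p u

open Classical in
/-- One more than the number of iterations left in the phase if `v` is in the middle of a phase in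
which it stalls, and `0` otherwise. -/
noncomputable def lift (R t : ℕ) (S : Set V) (v : V) : ℕ :=
  if t % R ≠ 0 ∧ v ∈ S then R - t % R + 1 else 0

/-- The potential of a node with load `d`, lift `J` and probability `p`. -/
noncomputable def pot (d : ℝ) (J : ℕ) (p : ℝ) : ℝ :=
  max (500 * d) ((3 / 2) ^ J) ^ 4 / (2 * p)

/-- An event witnessed in the two-hop neighborhood of `v` that forces `v` to be removed: some
non-halving node of the inclusive neighborhood of `v` is marked, and none of its neighbors could be
marked even with the largest possible probability. -/
def LocalJoin (R : ℕ) (θ : ℝ) (t : ℕ) (s : State V) (r : V → NodeCoins k) (v : V) : Prop :=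
  ∃ x, (x = v ∨ G.Adj v x) ∧ x ∈ s.active ∧ x ∉ halving G R θ t s r ∧
    ((r x).2 : ℝ) < markBound s x ∧
    ∀ w, G.Adj x w → w ∈ s.active → markBound s w ≤ ((r w).2 : ℝ)

open Classical in
/-- The potential of `v` before iteration `t`. -/
noncomputable def potential [Fintype V] (R : ℕ) (ε : ℝ) (t : ℕ) (s : State V) (v : V) : ℝ≥0∞ :=
  if v ∈ s.active then ENNReal.ofReal (pot (load G s s.p v) (lift R t s.stalling v) (s.p v) ^ ε)
  else 0

open Classical in
/-- An upper bound for the potential of `v` after iteration `t` that depends only on the coins in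
the two-hop neighborhood of `v`. -/
noncomputable def nextPotential [Fintype V] (R : ℕ) (θ ε : ℝ) (t : ℕ) (s : State V) (v : V)
    (r : V → NodeCoins k) : ℝ≥0∞ :=
  if v ∈ s.active ∧ ¬ LocalJoin G R θ t s r v then
    ENNReal.ofReal (pot (load G s (nextP G R θ t s r) v)
      (lift R (t + 1) (nextStalling G R θ t s r) v) (nextP G R θ t s r v) ^ ε)
  else 0

/-- The probabilities are of the form `2 ^ (-i)` with `i ≥ 1`. -/
def State.Dyadic (s : State V) : Prop := ∀ u, ∃ i : ℕ, s.p u = (1 / 2) ^ (i + 1)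

theorem State.Dyadic.pos {s : State V} (hs : s.Dyadic) (u : V) : 0 < s.p u := by
  obtain ⟨i, hi⟩ := hs u
  rw [hi]; positivity

theorem State.Dyadic.le_half {s : State V} (hs : s.Dyadic) (u : V) : s.p u ≤ 1 / 2 := by
  obtain ⟨i, hi⟩ := hs u
  rw [hi, pow_succ]
  have : ((1 : ℝ) / 2) ^ i ≤ 1 := pow_le_one₀ (by norm_num) (by norm_num)
  linarith

theorem State.init_dyadic : (State.init V).Dyadic := fun _ => ⟨0, by simp [State.init]⟩

theorem nextP_of_mem {R : ℕ} {θ : ℝ} {t : ℕ} {s : State V} {r : V → NodeCoins k} {v : V}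
    (h : v ∈ halving G R θ t s r) : nextP G R θ t s r v = s.p v / 2 := if_pos h

theorem nextP_of_notMem {R : ℕ} {θ : ℝ} {t : ℕ} {s : State V} {r : V → NodeCoins k} {v : V}
    (h : v ∉ halving G R θ t s r) : nextP G R θ t s r v = markBound s v := if_neg h

theorem State.Dyadic.step {s : State V} (hs : s.Dyadic) (R : ℕ) (θ : ℝ) (t : ℕ)
    (r : V → NodeCoins k) : (step G R θ t s r).Dyadic := by
  intro u
  obtain ⟨i, hi⟩ := hs u
  change ∃ i : ℕ, nextP G R θ t s r u = _
  by_cases h : u ∈ halving G R θ t s r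
  · exact ⟨i + 1, by rw [nextP_of_mem G h, hi, pow_succ]; ring⟩
  · rw [nextP_of_notMem G h, markBound]
    rcases i with _ | i
    · exact ⟨0, by rw [hi]; norm_num⟩
    · refine ⟨i, ?_⟩
      have : ((1 : ℝ) / 2) ^ i ≤ 1 := pow_le_one₀ (by norm_num) (by norm_num)
      rw [hi, min_eq_left, pow_succ _ (i + 1)]
      · ring
      · rw [pow_succ, pow_succ]; linarith

theorem State.Dyadic.nextP_pos {s : State V} (hs : s.Dyadic) (R : ℕ) (θ : ℝ) (t : ℕ)
    (r : V → NodeCoins k) (u : V) : 0 < nextP G R θ t s r u := (hs.step G R θ t r).pos u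

theorem State.Dyadic.le_markBound {s : State V} (hs : s.Dyadic) (u : V) :
    s.p u ≤ markBound s u :=
  le_min (by linarith [hs.pos u]) (hs.le_half u)

theorem State.Dyadic.markBound_pos {s : State V} (hs : s.Dyadic) (u : V) : 0 < markBound s u :=
  (hs.pos u).trans_le (hs.le_markBound u)

theorem State.Dyadic.nextP_le {s : State V} (hs : s.Dyadic) (R : ℕ) (θ : ℝ) (t : ℕ)
    (r : V → NodeCoins k) (u : V) : nextP G R θ t s r u ≤ markBound s u := by
  by_cases h : u ∈ halving G R θ t s r
  · rw [nextP_of_mem G h]; linarith [hs.le_markBound u, hs.pos u]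
  · rw [nextP_of_notMem G h]

theorem stateAfter_dyadic (R : ℕ) (θ : ℝ) {T : ℕ} (ω : Coins V T k) (t : ℕ) :
    (stateAfter G R θ ω t).Dyadic := by
  induction t with
  | zero => exact State.init_dyadic
  | succ t ih =>
    rw [stateAfter]
    split_ifs with h
    · exact ih.step G R θ t _
    · exact ih

theorem pot_nonneg {d : ℝ} {J : ℕ} {p : ℝ} (hp : 0 < p) : 0 ≤ pot d J p := by
  unfold pot; positivity

theorem one_le_pot {d : ℝ} {J : ℕ} {p : ℝ} (hp : 0 < p) (hp' : p ≤ 1 / 2) : 1 ≤ pot d J p := by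
  have h1 : (1 : ℝ) ≤ max (500 * d) ((3 / 2) ^ J) :=
    le_max_of_le_right (one_le_pow₀ (by norm_num))
  rw [pot, le_div_iff₀ (by positivity)]
  nlinarith [one_le_pow₀ (n := 4) h1]

theorem pot_mono {d d' : ℝ} (J : ℕ) {p : ℝ} (hp : 0 < p) (h : d ≤ d') :
    pot d J p ≤ pot d' J p := by
  unfold pot
  have : (0 : ℝ) ≤ max (500 * d) ((3 / 2) ^ J) := le_max_of_le_right (by positivity)
  gcongr

/-- The true marking probability of a neighbor of `x` depends on coins at distance three from `v`.
Comparing with `markBound`, which dominates it, excludes a mark without looking that far. -/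
theorem exists_mem_joining_of_localJoin {R : ℕ} {θ : ℝ} {t : ℕ} {s : State V} (hs : s.Dyadic)
    {r : V → NodeCoins k} {v : V} (h : LocalJoin G R θ t s r v) :
    ∃ x, (x = v ∨ G.Adj v x) ∧ x ∈ joining G R θ t s r := by
  obtain ⟨x, hxv, hx, hh, hlt, hw⟩ := h
  refine ⟨x, hxv, ⟨hx, fun h => hh (Or.inr h), ?_⟩, ?_⟩
  · rwa [nextP_of_notMem G hh]
  · rintro u hu ⟨hu1, -, hu2⟩
    exact absurd (hw u hu hu1) (not_le.2 (hu2.trans_le (hs.nextP_le G R θ t r u)))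

/-- `nextPotential` keeps the old set of neighbors in the load and recognizes only removals caused
by `LocalJoin`; both simplifications can only enlarge it. -/
theorem potential_step_le [Fintype V] (R : ℕ) (θ : ℝ) {ε : ℝ} (hε : 0 ≤ ε) (t : ℕ) {s : State V}
    (hs : s.Dyadic) (r : V → NodeCoins k) (v : V) :
    potential G R ε (t + 1) (step G R θ t s r) v ≤ nextPotential G R θ ε t s v r := by
  by_cases hv : v ∈ (step G R θ t s r).active
  · have hD : ¬ LocalJoin G R θ t s r v := by
      intro h
      obtain ⟨x, rfl | hx, hj⟩ := exists_mem_joining_of_localJoin G hs h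
      · exact hv.2.1 hj
      · exact hv.2.2 x hx hj
    rw [potential, if_pos hv, nextPotential, if_pos ⟨hv.1, hD⟩]
    have hp := hs.nextP_pos G R θ t r
    refine ENNReal.ofReal_le_ofReal (Real.rpow_le_rpow (pot_nonneg (hp v)) ?_ hε)
    refine pot_mono _ (hp v) ?_
    refine Finset.sum_le_sum_of_subset_of_nonneg ?_ fun u _ _ => (hp u).le
    intro u hu
    simp only [activeNbrs, Finset.mem_filter, Finset.mem_univ, true_and] at hu ⊢
    exact ⟨hu.1, hu.2.1⟩
  · rw [potential, if_neg hv]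
    exact zero_le

theorem one_le_potential [Fintype V] (R : ℕ) {ε : ℝ} (hε : 0 ≤ ε) (t : ℕ) {s : State V}
    (hs : s.Dyadic) {v : V} (hv : v ∈ s.active) : 1 ≤ potential G R ε t s v := by
  rw [potential, if_pos hv, ← ENNReal.ofReal_one]
  exact ENNReal.ofReal_le_ofReal (Real.one_le_rpow (one_le_pot (hs.pos v) (hs.le_half v)) hε)

section Locality

variable {G} {R : ℕ} {θ : ℝ} {t : ℕ} {s : State V} {r r' : V → NodeCoins k} {x : V}

theorem estimate_congr (h : ∀ u, G.Adj x u → r u = r' u) :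
    estimate G s r x = estimate G s r' x := by
  unfold estimate
  congr 1
  funext j
  unfold sampleCount
  congr 1
  ext u
  simp only [Set.mem_ofPred_eq]
  refine and_congr_right fun hu => ?_
  rw [h u hu]

theorem mem_nextStalling_congr (h : ∀ u, G.Adj x u → r u = r' u) :
    x ∈ nextStalling G R θ t s r ↔ x ∈ nextStalling G R θ t s r' := by
  unfold nextStalling
  split_ifs
  · simp only [Set.mem_ofPred_eq, estimate_congr h]
  · rfl

theorem mem_halving_congr (h : ∀ u, G.Adj x u → r u = r' u) :
    x ∈ halving G R θ t s r ↔ x ∈ halving G R θ t s r' := by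
  simp only [halving, Set.mem_ofPred_eq, estimate_congr h, mem_nextStalling_congr h]

theorem nextP_congr (h : ∀ u, G.Adj x u → r u = r' u) :
    nextP G R θ t s r x = nextP G R θ t s r' x := by
  unfold nextP
  congr 1; exact propext (by rw [estimate_congr h, mem_nextStalling_congr h])

end Locality

theorem mem_twoHop_self (v : V) : v ∈ twoHop G v := by simp [twoHop]

theorem mem_twoHop_of_adj {v u : V} (h : G.Adj v u) : u ∈ twoHop G v := by
  have := SimpleGraph.edist_eq_one_iff_adj.2 h
  simp only [twoHop, Set.mem_ofPred_eq, this]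
  norm_num

theorem mem_twoHop_of_adj_adj {v u w : V} (h : G.Adj v u) (h' : G.Adj u w) : w ∈ twoHop G v := by
  have h1 := SimpleGraph.edist_eq_one_iff_adj.2 h
  have h2 := SimpleGraph.edist_eq_one_iff_adj.2 h'
  calc G.edist v w ≤ G.edist v u + G.edist u w := SimpleGraph.edist_triangle ..
    _ = 2 := by rw [h1, h2]; norm_num

/-- The new load reads `nextP` at neighbors of `v`, hence sample coins at distance at most two;
`LocalJoin` stays within the same radius thanks to `markBound`. -/
theorem nextPotential_congr [Fintype V] (R : ℕ) (θ ε : ℝ) (t : ℕ) (s : State V) (v : V)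
    {r r' : V → NodeCoins k} (h : ∀ u ∈ twoHop G v, r u = r' u) :
    nextPotential G R θ ε t s v r = nextPotential G R θ ε t s v r' := by
  have h0 : ∀ u, G.Adj v u → r u = r' u := fun u hu => h u (mem_twoHop_of_adj G hu)
  have h1 : ∀ x, (x = v ∨ G.Adj v x) → ∀ u, G.Adj x u → r u = r' u := by
    rintro x (rfl | hx) u hu
    · exact h0 u hu
    · exact h u (mem_twoHop_of_adj_adj G hx hu)
  have hD : LocalJoin G R θ t s r v ↔ LocalJoin G R θ t s r' v := by
    unfold LocalJoin
    refine exists_congr fun x => and_congr_right fun hx => and_congr_right fun _ => ?_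
    rw [mem_halving_congr (h1 x hx)]
    have hxr : r x = r' x := by
      rcases hx with rfl | hx
      · exact h _ (mem_twoHop_self G _)
      · exact h0 x hx
    rw [hxr]
    refine and_congr_right fun _ => and_congr_right fun _ => forall_congr' fun w =>
      forall_congr' fun hw => ?_
    rw [h1 x hx w hw]
  have hl : load G s (nextP G R θ t s r) v = load G s (nextP G R θ t s r') v := by
    refine Finset.sum_congr rfl fun u hu => ?_
    simp only [activeNbrs, Finset.mem_filter, Finset.mem_univ, true_and] at hu
    exact nextP_congr (h1 u (Or.inr hu.1))
  have hst : lift R (t + 1) (nextStalling G R θ t s r) v =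
      lift R (t + 1) (nextStalling G R θ t s r') v := by
    unfold lift
    congr 1; exact propext (by rw [mem_nextStalling_congr h0])
  unfold nextPotential
  rw [hl, hst, nextP_congr h0]
  congr 1; exact propext (by rw [hD])

end Dynamics

/-! ### Numerical side conditions and the evolution of the lift. -/

/-- The inequalities between the phase length, the stalling threshold and the number of repetitions
that the analysis uses. -/
structure Admissible (R : ℕ) (θ : ℝ) (k : ℕ) : Prop where
  one_le_R : 1 ≤ R
  one_le_θ : 1 ≤ θ
  pow_le_θ : (3 / 2 : ℝ) ^ (R + 1) ≤ 5 / 2 * θ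
  pow_le_k : ((3 / 2 : ℝ) ^ R) ^ 4 ≤ 2 ^ k

/-- Used with (c, e) = (2/3, 1/2), giving 32/81 < 1/2; with (1, 2), giving 1/2; and with (2, 1/2),
giving 32. -/
theorem pot_le_mul {d d' : ℝ} {J J' : ℕ} {p p' c e : ℝ} (hp : 0 < p) (he : 0 < e)
    (hpp : e * p ≤ p')
    (h : max (500 * d') ((3 / 2) ^ J') ≤ c * max (500 * d) ((3 / 2) ^ J)) :
    pot d' J' p' ≤ c ^ 4 / e * pot d J p := by
  have h0 : (0 : ℝ) ≤ max (500 * d') ((3 / 2) ^ J') := le_max_of_le_right (by positivity)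
  have h1 : max (500 * d') ((3 / 2) ^ J') ^ 4 ≤ c ^ 4 * max (500 * d) ((3 / 2) ^ J) ^ 4 := by
    rw [← mul_pow]; gcongr
  have h2 : 0 < e * p := by positivity
  unfold pot
  calc _ ≤ c ^ 4 * max (500 * d) ((3 / 2) ^ J) ^ 4 / (2 * (e * p)) := by gcongr
    _ = _ := by field_simp

section Lift

variable {V : Type*} {G : SimpleGraph V} {k R : ℕ} {θ : ℝ} {t : ℕ} {s : State V} {v : V}
  {r : V → NodeCoins k}

theorem lift_step_of_notMem (h : v ∉ nextStalling G R θ t s r) :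
    lift R (t + 1) (nextStalling G R θ t s r) v = 0 := by
  simp [lift, h]

theorem lift_step_le (hR : 1 ≤ R) : lift R (t + 1) (nextStalling G R θ t s r) v ≤ R := by
  unfold lift
  split_ifs with h
  · have := h.1
    omega
  · omega

/-- The extra one in `lift` keeps it at least 2 up to the last stalled iteration, after which it
falls to 0; this slack is what absorbs a very small load. -/
theorem lift_step_of_mem (hR : 1 ≤ R) (ht : t % R ≠ 0) (h : v ∈ nextStalling G R θ t s r) :
    lift R (t + 1) (nextStalling G R θ t s r) v + 1 ≤ lift R t s.stalling v ∧
      2 ≤ lift R t s.stalling v := by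
  have hv : v ∈ s.stalling := by rwa [nextStalling, if_neg ht] at h
  have hlt : t % R < R := Nat.mod_lt _ hR
  unfold lift
  rw [if_pos (c := t % R ≠ 0 ∧ v ∈ s.stalling) ⟨ht, hv⟩]
  split_ifs with h'
  · have h1 : (t + 1) % R = t % R + 1 := by
      rcases Nat.lt_or_ge (t % R + 1) R with h2 | h2
      · have : 1 % R = 1 := Nat.mod_eq_of_lt (by omega)
        rw [Nat.add_mod, this, Nat.mod_eq_of_lt h2]
      · have h3 : t % R + 1 = R := by omega
        have h4 : R ∣ t + 1 := ⟨t / R + 1, by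
          have := Nat.div_add_mod t R
          rw [Nat.mul_add, mul_one]; omega⟩
        exact absurd (Nat.mod_eq_zero_of_dvd h4) h'.1
    omega
  · omega

theorem half_le_nextP (hs : s.Dyadic) : 1 / 2 * s.p v ≤ nextP G R θ t s r v := by
  by_cases h : v ∈ halving G R θ t s r
  · rw [nextP_of_mem G h]; linarith
  · rw [nextP_of_notMem G h]; linarith [hs.le_markBound v, hs.pos v]

end Lift

/-! ### Change of the potential in one iteration, for fixed coins. -/

section Pathwise

variable {V : Type*} [Fintype V] (G : SimpleGraph V) {k : ℕ}

open Classical in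
/-- The non-halving nodes with small load in the inclusive neighborhood of `v`. -/
noncomputable def goodNbrs (R : ℕ) (θ : ℝ) (t : ℕ) (s : State V) (v : V) (r : V → NodeCoins k) :
    Finset V :=
  {x | (x = v ∨ G.Adj v x) ∧ x ∈ s.active ∧ x ∉ halving G R θ t s r ∧ load G s s.p x ≤ 10}

/-- Good nodes have a non-negligible marking probability in total. -/
def Golden (R : ℕ) (θ : ℝ) (t : ℕ) (s : State V) (v : V) (r : V → NodeCoins k) : Prop :=
  1 / 18000 ≤ ∑ x ∈ goodNbrs G R θ t s v r, markBound s x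

open Classical in
/-- The total probability of the non-halving remaining neighbors with large load. -/
noncomputable def badWeight (R : ℕ) (θ : ℝ) (t : ℕ) (s : State V) (v : V) (r : V → NodeCoins k) :
    ℝ :=
  ∑ x ∈ activeNbrs G s v, if x ∉ halving G R θ t s r ∧ 10 < load G s s.p x then s.p x else 0

/-- The estimates around `v` are misleading. -/
def Misled (R : ℕ) (θ : ℝ) (t : ℕ) (s : State V) (v : V) (r : V → NodeCoins k) : Prop :=
  (v ∉ halving G R θ t s r ∧ 10 < load G s s.p v) ∨
  (0 < load G s s.p v ∧ load G s s.p v / 18 ≤ badWeight G R θ t s v r) ∨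
  (2 ≤ estimate G s r v ∧ load G s s.p v < 2 / 200) ∨
  (θ ≤ estimate G s r v ∧ load G s s.p v < θ / 200)

variable {G} {R : ℕ} {θ : ℝ} {t : ℕ} {s : State V} {v : V} {r : V → NodeCoins k}

theorem load_nextP_le_two_mul (hs : s.Dyadic) :
    load G s (nextP G R θ t s r) v ≤ 2 * load G s s.p v := by
  unfold load
  rw [Finset.mul_sum]
  exact Finset.sum_le_sum fun u _ => (hs.nextP_le G R θ t r u).trans (min_le_left _ _)

/-- Every neighbor contributes half its old probability, plus at most 3/2 of it if it does not
halve. Non-halving neighbors are either good, of total weight below 1/18000 ≤ load/18, or bad, of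
total weight below load/18. Finally 1/2 + (3/2)(2/18) = 2/3. -/
theorem load_nextP_le_of_not_golden (hs : s.Dyadic) (hg : ¬ Golden G R θ t s v r)
    (hm : ¬ Misled G R θ t s v r) (hd : 1 / 1000 ≤ load G s s.p v) :
    load G s (nextP G R θ t s r) v ≤ 2 / 3 * load G s s.p v := by
  classical
  have hb : badWeight G R θ t s v r < load G s s.p v / 18 := by
    by_contra h
    exact hm (Or.inr (Or.inl ⟨by linarith, not_lt.1 h⟩))
  have hgood : ∑ x ∈ activeNbrs G s v,
      (if x ∉ halving G R θ t s r ∧ load G s s.p x ≤ 10 then s.p x else 0) ≤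
      ∑ x ∈ goodNbrs G R θ t s v r, markBound s x := by
    rw [← Finset.sum_filter]
    refine (Finset.sum_le_sum fun x _ => hs.le_markBound x).trans ?_
    refine Finset.sum_le_sum_of_subset_of_nonneg ?_ fun x _ _ => (hs.markBound_pos x).le
    intro x hx
    simp only [activeNbrs, goodNbrs, Finset.mem_filter, Finset.mem_univ, true_and] at hx ⊢
    exact ⟨Or.inr hx.1.1, hx.1.2, hx.2⟩
  have hg' : ∑ x ∈ goodNbrs G R θ t s v r, markBound s x < 1 / 18000 := not_le.1 hg
  have hsplit : load G s (nextP G R θ t s r) v ≤ 1 / 2 * load G s s.p v + 3 / 2 *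
      (∑ x ∈ activeNbrs G s v,
        (if x ∉ halving G R θ t s r ∧ load G s s.p x ≤ 10 then s.p x else 0) +
        badWeight G R θ t s v r) := by
    unfold load badWeight
    rw [← Finset.sum_add_distrib, Finset.mul_sum, Finset.mul_sum, ← Finset.sum_add_distrib]
    refine Finset.sum_le_sum fun x _ => ?_
    have hx0 := hs.pos x
    by_cases hx : x ∈ halving G R θ t s r
    · rw [nextP_of_mem G hx]
      simp only [hx, not_true_eq_false, false_and, if_false]
      linarith
    · have h1 : nextP G R θ t s r x ≤ 2 * s.p x := by
        rw [nextP_of_notMem G hx]; exact min_le_left _ _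
      by_cases hl : load G s s.p x ≤ 10
      · rw [if_pos ⟨hx, hl⟩, if_neg fun h => h.2.not_ge hl]
        linarith
      · rw [if_neg fun h => hl h.2, if_pos ⟨hx, not_le.1 hl⟩]
        linarith
  linarith

/-- When a phase starts, stalling is backed by a load of at least θ/200, so 500 times the load is at
least (5/2)θ ≥ (3/2)^(R+1), which pays for the new lift. Within a phase the lift just drops by at
least one. -/
theorem pow_lift_le_two_thirds (ha : Admissible R θ k)
    (hm : ¬ Misled G R θ t s v r) (h : v ∈ nextStalling G R θ t s r) :
    (3 / 2 : ℝ) ^ lift R (t + 1) (nextStalling G R θ t s r) v ≤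
      2 / 3 * max (500 * load G s s.p v) ((3 / 2) ^ lift R t s.stalling v) := by
  by_cases ht : t % R = 0
  · have hθ : θ ≤ estimate G s r v := by rwa [nextStalling, if_pos ht] at h
    have hd : θ / 200 ≤ load G s s.p v := by
      by_contra h'
      exact hm (Or.inr (Or.inr (Or.inr ⟨hθ, not_le.1 h'⟩)))
    have h1 : (3 / 2 : ℝ) ^ lift R (t + 1) (nextStalling G R θ t s r) v ≤ (3 / 2) ^ R :=
      pow_le_pow_right₀ (by norm_num) (lift_step_le ha.one_le_R)
    have h2 := ha.pow_le_θ
    rw [pow_succ] at h2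
    have h3 := le_max_left (500 * load G s s.p v) ((3 / 2 : ℝ) ^ lift R t s.stalling v)
    linarith
  · have h1 := (lift_step_of_mem ha.one_le_R ht h).1
    have h2 : (3 / 2 : ℝ) ^ (lift R (t + 1) (nextStalling G R θ t s r) v + 1) ≤
        (3 / 2) ^ lift R t s.stalling v := pow_le_pow_right₀ (by norm_num) h1
    rw [pow_succ] at h2
    have h3 := le_max_right (500 * load G s s.p v) ((3 / 2 : ℝ) ^ lift R t s.stalling v)
    linarith

theorem pot_step_le_of_not_misled (ha : Admissible R θ k) (hs : s.Dyadic)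
    (hm : ¬ Misled G R θ t s v r) :
    pot (load G s (nextP G R θ t s r) v) (lift R (t + 1) (nextStalling G R θ t s r) v)
      (nextP G R θ t s r v) ≤ 32 * pot (load G s s.p v) (lift R t s.stalling v) (s.p v) := by
  have := pot_le_mul (c := 2) (hs.pos v) (by norm_num : (0 : ℝ) < 1 / 2)
    (half_le_nextP (R := R) (θ := θ) (t := t) (r := r) (G := G) hs)
    (d := load G s s.p v) (J := lift R t s.stalling v)
    (d' := load G s (nextP G R θ t s r) v)
    (J' := lift R (t + 1) (nextStalling G R θ t s r) v) ?_
  · norm_num at this ⊢; exact this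
  have h1 := le_max_left (500 * load G s s.p v) ((3 / 2 : ℝ) ^ lift R t s.stalling v)
  have h2 := load_nextP_le_two_mul (G := G) (R := R) (θ := θ) (t := t) (v := v) (r := r) hs
  have h3 : (1 : ℝ) ≤ max (500 * load G s s.p v) ((3 / 2 : ℝ) ^ lift R t s.stalling v) :=
    le_max_of_le_right (one_le_pow₀ (by norm_num))
  refine max_le (by linarith) ?_
  by_cases h : v ∈ nextStalling G R θ t s r
  · linarith [pow_lift_le_two_thirds ha hm h]
  · rw [lift_step_of_notMem h, pow_zero]; linarith

/-- This covers misled iterations, where a wrongly stalling node may acquire a lift of up to R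
without a large load; the fourth power of (3/2)^R is at most 2^k. -/
theorem pot_step_le (ha : Admissible R θ k) (hs : s.Dyadic) :
    pot (load G s (nextP G R θ t s r) v) (lift R (t + 1) (nextStalling G R θ t s r) v)
      (nextP G R θ t s r v) ≤
      32 * 2 ^ k * pot (load G s s.p v) (lift R t s.stalling v) (s.p v) := by
  have := pot_le_mul (c := 2 * (3 / 2) ^ R) (hs.pos v) (by norm_num : (0 : ℝ) < 1 / 2)
    (half_le_nextP (R := R) (θ := θ) (t := t) (r := r) (G := G) hs)
    (d := load G s s.p v) (J := lift R t s.stalling v)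
    (d' := load G s (nextP G R θ t s r) v)
    (J' := lift R (t + 1) (nextStalling G R θ t s r) v) ?_
  · refine this.trans (mul_le_mul_of_nonneg_right ?_ (pot_nonneg (hs.pos v)))
    rw [mul_pow]
    linarith [ha.pow_le_k]
  have h1 := le_max_left (500 * load G s s.p v) ((3 / 2 : ℝ) ^ lift R t s.stalling v)
  have h2 := load_nextP_le_two_mul (G := G) (R := R) (θ := θ) (t := t) (v := v) (r := r) hs
  have h3 : (1 : ℝ) ≤ max (500 * load G s s.p v) ((3 / 2 : ℝ) ^ lift R t s.stalling v) :=
    le_max_of_le_right (one_le_pow₀ (by norm_num))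
  have h4 : (1 : ℝ) ≤ (3 / 2) ^ R := one_le_pow₀ (by norm_num)
  have h5 : (3 / 2 : ℝ) ^ lift R (t + 1) (nextStalling G R θ t s r) v ≤ (3 / 2) ^ R :=
    pow_le_pow_right₀ (by norm_num) (lift_step_le ha.one_le_R)
  refine max_le ?_ ?_
  · nlinarith
  · nlinarith

/-- If `v` halves, its load or lift must have been large, and the maximum falls by 2/3. If it does
not halve, its probability truly doubles and the maximum does not rise. -/
theorem pot_step_le_half (ha : Admissible R θ k) (hs : s.Dyadic) (hv : v ∈ s.active)
    (hg : ¬ Golden G R θ t s v r) (hm : ¬ Misled G R θ t s v r) :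
    pot (load G s (nextP G R θ t s r) v) (lift R (t + 1) (nextStalling G R θ t s r) v)
      (nextP G R θ t s r v) ≤ 1 / 2 * pot (load G s s.p v) (lift R t s.stalling v) (s.p v) := by
  have hM1 := le_max_left (500 * load G s s.p v) ((3 / 2 : ℝ) ^ lift R t s.stalling v)
  have hM0 : (1 : ℝ) ≤ max (500 * load G s s.p v) ((3 / 2 : ℝ) ^ lift R t s.stalling v) :=
    le_max_of_le_right (one_le_pow₀ (by norm_num))
  have hd2 := load_nextP_le_two_mul (G := G) (R := R) (θ := θ) (t := t) (v := v) (r := r) hs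
  by_cases hh : v ∈ halving G R θ t s r
  · have h23 : max (500 * load G s (nextP G R θ t s r) v)
        ((3 / 2) ^ lift R (t + 1) (nextStalling G R θ t s r) v) ≤
        2 / 3 * max (500 * load G s s.p v) ((3 / 2) ^ lift R t s.stalling v) := by
      by_cases hst : v ∈ nextStalling G R θ t s r
      · refine max_le ?_ (pow_lift_le_two_thirds ha hm hst)
        by_cases hd : 1 / 1000 ≤ load G s s.p v
        · linarith [load_nextP_le_of_not_golden hs hg hm hd]
        -- With load below 1/1000, stalling decided now would be misled because θ ≥ 1. In mid-phase
        -- the lift is at least 2, and (2/3)(9/4) exceeds 1, hence 1000 times the load.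
        · by_cases ht : t % R = 0
          · have hθ : θ ≤ estimate G s r v := by rwa [nextStalling, if_pos ht] at hst
            refine absurd (Or.inr (Or.inr (Or.inr ⟨hθ, ?_⟩))) hm
            linarith [ha.one_le_θ]
          · have h1 : (3 / 2 : ℝ) ^ 2 ≤ (3 / 2) ^ lift R t s.stalling v :=
              pow_le_pow_right₀ (by norm_num) (lift_step_of_mem ha.one_le_R ht hst).2
            have h3 := le_max_right (500 * load G s s.p v) ((3 / 2 : ℝ) ^ lift R t s.stalling v)
            norm_num at h1
            linarith
      · have hest : 2 ≤ estimate G s r v := hh.resolve_right hst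
        have hd : 2 / 200 ≤ load G s s.p v := by
          by_contra h'
          exact hm (Or.inr (Or.inr (Or.inl ⟨hest, not_le.1 h'⟩)))
        have h1 := load_nextP_le_of_not_golden hs hg hm (by linarith)
        rw [lift_step_of_notMem hst, pow_zero]
        exact max_le (by linarith) (by linarith)
    refine (pot_le_mul (hs.pos v) (by norm_num : (0 : ℝ) < 1 / 2)
      (half_le_nextP (R := R) (θ := θ) (t := t) (r := r) (G := G) hs) h23).trans ?_
    exact mul_le_mul_of_nonneg_right (by norm_num) (pot_nonneg (hs.pos v))
  · have hd10 : load G s s.p v ≤ 10 := by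
      by_contra h'
      exact hm (Or.inl ⟨hh, not_le.1 h'⟩)
    have hst : v ∉ nextStalling G R θ t s r := fun h => hh (Or.inr h)
    -- Here `v` is itself one of the good nodes, so the failure of `Golden` makes its probability
    -- tiny and the cap 1/2 inactive.
    have hq : markBound s v < 1 / 18000 := by
      refine lt_of_le_of_lt ?_ (not_le.1 hg)
      refine Finset.single_le_sum (f := markBound s) (fun x _ => (hs.markBound_pos x).le) ?_
      simp only [goodNbrs, Finset.mem_filter, Finset.mem_univ, true_and]
      exact ⟨Or.inl trivial, hv, hh, hd10⟩
    have hp : 2 * s.p v ≤ nextP G R θ t s r v := by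
      rw [nextP_of_notMem G hh]
      refine le_min le_rfl ?_
      by_contra h'
      rw [markBound, min_eq_right (not_le.1 h').le] at hq
      norm_num at hq
    refine (pot_le_mul (c := 1) (hs.pos v) two_pos hp ?_).trans
      (mul_le_mul_of_nonneg_right (by norm_num) (pot_nonneg (hs.pos v)))
    rw [one_mul, lift_step_of_notMem hst, pow_zero]
    refine max_le ?_ hM0
    by_cases hd : 1 / 1000 ≤ load G s s.p v
    · linarith [load_nextP_le_of_not_golden hs hg hm hd]
    · linarith

-- The misled term is added instead of being a separate branch, so the two expectations can be
-- bounded separately although the events are dependent.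
open Classical in
theorem nextPotential_le (ha : Admissible R θ k) (hs : s.Dyadic) {ε : ℝ} (hε : 0 < ε)
    (hε1 : ε ≤ 1) (v : V) (r : V → NodeCoins k) :
    nextPotential G R θ ε t s v r ≤ potential G R ε t s v *
      ((if Golden G R θ t s v r then
          if LocalJoin G R θ t s r v then 0 else ENNReal.ofReal (32 ^ ε)
        else ENNReal.ofReal (2⁻¹ ^ ε)) +
      if Misled G R θ t s v r then 32 * 2 ^ k else 0) := by
  by_cases hv : v ∈ s.active
  swap
  · rw [nextPotential, if_neg fun h => hv h.1]
    exact zero_le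
  by_cases hD : LocalJoin G R θ t s r v
  · rw [nextPotential, if_neg fun h => h.2 hD]
    exact zero_le
  have hY := pot_nonneg (d := load G s s.p v) (J := lift R t s.stalling v) (hs.pos v)
  have hY' := pot_nonneg (d := load G s (nextP G R θ t s r) v)
    (J := lift R (t + 1) (nextStalling G R θ t s r) v) (hs.nextP_pos G R θ t r v)
  have key : ∀ c : ℝ, 0 ≤ c → pot (load G s (nextP G R θ t s r) v)
      (lift R (t + 1) (nextStalling G R θ t s r) v) (nextP G R θ t s r v) ≤
      c * pot (load G s s.p v) (lift R t s.stalling v) (s.p v) →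
      nextPotential G R θ ε t s v r ≤ potential G R ε t s v * ENNReal.ofReal (c ^ ε) := by
    intro c hc h
    rw [nextPotential, if_pos ⟨hv, hD⟩, potential, if_pos hv,
      ← ENNReal.ofReal_mul (Real.rpow_nonneg hY _), mul_comm, ← Real.mul_rpow hc hY]
    exact ENNReal.ofReal_le_ofReal (Real.rpow_le_rpow hY' h hε.le)
  by_cases hm : Misled G R θ t s v r
  · refine (key _ (by positivity) (pot_step_le ha hs)).trans ?_
    rw [if_pos hm]
    refine mul_le_mul_right (le_add_left ?_) _
    have h1 : (1 : ℝ) ≤ 32 * 2 ^ k := by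
      have := one_le_pow₀ (n := k) (one_le_two : (1 : ℝ) ≤ 2)
      linarith
    calc ENNReal.ofReal ((32 * 2 ^ k) ^ ε) ≤ ENNReal.ofReal ((32 * 2 ^ k) ^ (1 : ℝ)) :=
          ENNReal.ofReal_le_ofReal (Real.rpow_le_rpow_of_exponent_le h1 hε1)
      _ = 32 * 2 ^ k := by
          rw [Real.rpow_one, ENNReal.ofReal_mul (by norm_num), ENNReal.ofReal_pow (by norm_num)]
          norm_num
  · rw [if_neg hm, add_zero, if_neg hD]
    split_ifs with hg
    · exact key _ (by norm_num) (pot_step_le_of_not_misled ha hs hm)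
    · refine key _ (by norm_num) ?_
      have := pot_step_le_half ha hs hv hg hm
      rwa [one_div] at this

end Pathwise

open Classical in
theorem sampleCount_eq_sum {V : Type*} [Fintype V] (G : SimpleGraph V) {k : ℕ} (s : State V)
    (r : V → NodeCoins k) (v : V) (j : Fin k) :
    sampleCount G s r v j =
      ∑ u ∈ activeNbrs G s v, if (((r u).1 j : unitInterval) : ℝ) < s.p u then 1 else 0 := by
  rw [← Finset.card_filter, sampleCount, ← Set.ncard_coe_finset]
  congr 1
  ext u
  simp [activeNbrs, and_assoc]

/-! ### Measurability of the random state and of the events derived from it. -/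

section Measurability

variable {V : Type*} {k : ℕ} {Ω : Type*} [MeasurableSpace Ω]

/-- A random state all of whose components are measurable. -/
structure MeasurableState (s : Ω → State V) : Prop where
  active : ∀ v, MeasurableSet {ω | v ∈ (s ω).active}
  mis : ∀ v, MeasurableSet {ω | v ∈ (s ω).mis}
  stalling : ∀ v, MeasurableSet {ω | v ∈ (s ω).stalling}
  p : ∀ v, Measurable fun ω => (s ω).p v

theorem measurableState_const (s : State V) : MeasurableState fun _ : Ω => s :=
  ⟨fun _ => .const _, fun _ => .const _, fun _ => .const _, fun _ => measurable_const⟩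

variable {s : Ω → State V} {r : Ω → V → NodeCoins k}

theorem measurable_mark (hr : Measurable r) (v : V) :
    Measurable fun ω => ((r ω v).2 : ℝ) := by fun_prop

theorem measurable_sample (hr : Measurable r) (v : V) (j : Fin k) :
    Measurable fun ω => (((r ω v).1 j : unitInterval) : ℝ) :=
  measurable_subtype_coe.comp
    ((measurable_pi_apply j).comp (measurable_fst.comp ((measurable_pi_apply v).comp hr)))

theorem measurable_markBound (hs : MeasurableState s) (v : V) :
    Measurable fun ω => markBound (s ω) v :=
  ((hs.p v).const_mul 2).min measurable_const

theorem measurable_lift (R t : ℕ) {S : Ω → Set V} {v : V} (hS : MeasurableSet {ω | v ∈ S ω}) :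
    Measurable fun ω => lift R t (S ω) v := by
  classical
  exact Measurable.ite ((MeasurableSet.const _).inter hS) measurable_const measurable_const

variable [Fintype V] {G : SimpleGraph V}

theorem measurable_estimate (hs : MeasurableState s) (hr : Measurable r) (v : V) :
    Measurable fun ω => estimate G (s ω) (r ω) v := by
  classical
  have h : Measurable fun ω => sampleCount G (s ω) (r ω) v := by
    refine measurable_pi_iff.2 fun j => ?_
    have : (fun ω => sampleCount G (s ω) (r ω) v j) = fun ω => ∑ u : V,
        if (G.Adj v u ∧ u ∈ (s ω).active) ∧ (((r ω u).1 j : unitInterval) : ℝ) < (s ω).p u then 1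
        else 0 := by
      funext ω
      rw [sampleCount_eq_sum, activeNbrs, Finset.sum_filter]
      refine Finset.sum_congr rfl fun u _ => ?_
      split_ifs <;> simp_all
    rw [this]
    refine Finset.measurable_sum _ fun u _ => Measurable.ite ?_ measurable_const measurable_const
    exact ((MeasurableSet.const _).inter (hs.active u)).inter
      (measurableSet_lt (measurable_sample hr u j) (hs.p u))
  exact (measurable_of_countable (median : (Fin k → ℕ) → ℝ)).comp h

variable (R : ℕ) (θ : ℝ) (t : ℕ)

theorem measurableSet_nextStalling (hs : MeasurableState s) (hr : Measurable r) (v : V) :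
    MeasurableSet {ω | v ∈ nextStalling G R θ t (s ω) (r ω)} := by
  unfold nextStalling
  split_ifs
  · exact measurableSet_le measurable_const (measurable_estimate hs hr v)
  · exact hs.stalling v

theorem measurableSet_halving (hs : MeasurableState s) (hr : Measurable r) (v : V) :
    MeasurableSet {ω | v ∈ halving G R θ t (s ω) (r ω)} :=
  (measurableSet_le measurable_const (measurable_estimate hs hr v)).union
    (measurableSet_nextStalling R θ t hs hr v)

theorem measurable_nextP (hs : MeasurableState s) (hr : Measurable r) (v : V) :
    Measurable fun ω => nextP G R θ t (s ω) (r ω) v := by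
  classical
  exact Measurable.ite (measurableSet_halving R θ t hs hr v) ((hs.p v).div_const 2)
    (measurable_markBound hs v)

theorem measurableSet_marked (hs : MeasurableState s) (hr : Measurable r) (v : V) :
    MeasurableSet {ω | v ∈ marked G R θ t (s ω) (r ω)} :=
  (hs.active v).inter ((measurableSet_nextStalling R θ t hs hr v).compl.inter
    (measurableSet_lt (measurable_mark hr v) (measurable_nextP R θ t hs hr v)))

theorem measurableSet_forall_adj {p : V → Ω → Prop} (v : V)
    (h : ∀ u, MeasurableSet {ω | p u ω}) : MeasurableSet {ω | ∀ u, G.Adj v u → p u ω} :=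
  measurableSet_setOfPred.2 (Measurable.forall fun u =>
    measurableSet_setOfPred.1 (MeasurableSet.imp (.const _) (h u)))

theorem measurableSet_joining (hs : MeasurableState s) (hr : Measurable r) (v : V) :
    MeasurableSet {ω | v ∈ joining G R θ t (s ω) (r ω)} :=
  (measurableSet_marked R θ t hs hr v).inter
    (measurableSet_forall_adj v fun u => (measurableSet_marked R θ t hs hr u).compl)

theorem MeasurableState.step (hs : MeasurableState s) (hr : Measurable r) :
    MeasurableState fun ω => step G R θ t (s ω) (r ω) where
  active v := (hs.active v).inter ((measurableSet_joining R θ t hs hr v).compl.inter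
    (measurableSet_forall_adj v fun u => (measurableSet_joining R θ t hs hr u).compl))
  mis v := (hs.mis v).union (measurableSet_joining R θ t hs hr v)
  stalling v := measurableSet_nextStalling R θ t hs hr v
  p v := measurable_nextP R θ t hs hr v

theorem measurableState_stateAfter {T : ℕ} {F : Ω → Coins V T k} (hF : Measurable F) (t : ℕ) :
    MeasurableState fun ω => stateAfter G R θ (F ω) t := by
  induction t with
  | zero => exact measurableState_const _
  | succ t ih =>
    simp only [stateAfter]
    split_ifs with h
    · exact ih.step R θ t ((measurable_pi_apply _).comp hF)
    · exact ih

theorem measurableSet_localJoin (hs : MeasurableState s) (hr : Measurable r) (v : V) :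
    MeasurableSet {ω | LocalJoin G R θ t (s ω) (r ω) v} := by
  refine measurableSet_setOfPred.2 (Measurable.exists fun x => measurableSet_setOfPred.1 ?_)
  refine (MeasurableSet.const _).inter ((hs.active x).inter
    ((measurableSet_halving R θ t hs hr x).compl.inter
      ((measurableSet_lt (measurable_mark hr x) (measurable_markBound hs x)).inter ?_)))
  exact measurableSet_forall_adj x fun w => MeasurableSet.imp (hs.active w)
    (measurableSet_le (measurable_markBound hs w) (measurable_mark hr w))

theorem measurable_load {p : Ω → V → ℝ} (hs : MeasurableState s)
    (hp : ∀ v, Measurable fun ω => p ω v) (v : V) :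
    Measurable fun ω => load G (s ω) (p ω) v := by
  classical
  simp only [load, activeNbrs, Finset.sum_filter]
  refine Finset.measurable_sum _ fun u _ => Measurable.ite ?_ (hp u) measurable_const
  exact (MeasurableSet.const _).inter (hs.active u)

theorem measurable_pot {d p : Ω → ℝ} {J : Ω → ℕ} (hd : Measurable d) (hJ : Measurable J)
    (hp : Measurable p) : Measurable fun ω => pot (d ω) (J ω) (p ω) := by
  unfold pot
  have : Measurable fun ω => (3 / 2 : ℝ) ^ J ω :=
    (measurable_of_countable fun n : ℕ => (3 / 2 : ℝ) ^ n).comp hJ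
  exact (((hd.const_mul 500).max this).pow_const 4).div (hp.const_mul 2)

theorem measurable_potential (ε : ℝ) (hs : MeasurableState s) (v : V) :
    Measurable fun ω => potential G R ε t (s ω) v := by
  classical
  refine Measurable.ite (hs.active v) (ENNReal.measurable_ofReal.comp ?_) measurable_const
  exact (measurable_pot (measurable_load hs hs.p v) (measurable_lift R t (hs.stalling v))
    (hs.p v)).pow_const ε

theorem measurable_nextPotential (ε : ℝ) (hs : MeasurableState s) (hr : Measurable r) (v : V) :
    Measurable fun ω => nextPotential G R θ ε t (s ω) v (r ω) := by
  classical
  refine Measurable.ite ((hs.active v).inter (measurableSet_localJoin R θ t hs hr v).compl)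
    (ENNReal.measurable_ofReal.comp ?_) measurable_const
  exact (measurable_pot (measurable_load hs (measurable_nextP R θ t hs hr) v)
    (measurable_lift R (t + 1) (measurableSet_nextStalling R θ t hs hr v))
    (measurable_nextP R θ t hs hr v)).pow_const ε

theorem measurableSet_golden (hs : MeasurableState s) (hr : Measurable r) (v : V) :
    MeasurableSet {ω | Golden G R θ t (s ω) v (r ω)} := by
  classical
  simp only [Golden, goodNbrs, Finset.sum_filter]
  refine measurableSet_le measurable_const (Finset.measurable_sum _ fun x _ =>
    Measurable.ite ?_ (measurable_markBound hs x) measurable_const)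
  exact (MeasurableSet.const _).inter ((hs.active x).inter
    ((measurableSet_halving R θ t hs hr x).compl.inter
      (measurableSet_le (measurable_load hs hs.p x) measurable_const)))

theorem measurable_badWeight (hs : MeasurableState s) (hr : Measurable r) (v : V) :
    Measurable fun ω => badWeight G R θ t (s ω) v (r ω) := by
  classical
  simp only [badWeight, activeNbrs, Finset.sum_filter]
  refine Finset.measurable_sum _ fun x _ => Measurable.ite
    ((MeasurableSet.const _).inter (hs.active x))
    (Measurable.ite ?_ (hs.p x) measurable_const) measurable_const
  exact (measurableSet_halving R θ t hs hr x).compl.inter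
    (measurableSet_lt measurable_const (measurable_load hs hs.p x))

end Measurability

/-! ### Uniform coins and products of independent factors. -/

section Uniform

theorem volume_coe_lt {p : ℝ} (h0 : 0 ≤ p) (h1 : p ≤ 1) :
    volume {x : unitInterval | (x : ℝ) < p} = ENNReal.ofReal p :=
  unitInterval.volume_Iio ⟨p, h0, h1⟩

theorem volume_le_coe {p : ℝ} (h0 : 0 ≤ p) (h1 : p ≤ 1) :
    volume {x : unitInterval | p ≤ (x : ℝ)} = ENNReal.ofReal (1 - p) :=
  unitInterval.volume_Ici ⟨p, h0, h1⟩

theorem lintegral_pi_prod {ι : Type*} [Fintype ι] {α : ι → Type*} [∀ i, MeasurableSpace (α i)]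
    (μ : ∀ i, Measure (α i)) [∀ i, IsProbabilityMeasure (μ i)] (S : Finset ι)
    {f : ∀ i, α i → ℝ≥0∞} (hf : ∀ i, Measurable (f i)) :
    ∫⁻ x, ∏ i ∈ S, f i (x i) ∂Measure.pi μ = ∏ i ∈ S, ∫⁻ y, f i y ∂μ i := by
  have := ProbabilityTheory.lintegral_prod_eq_prod_lintegral_of_indepFun S
    (fun i (x : ∀ i, α i) => f i (x i))
    (ProbabilityTheory.iIndepFun_pi (μ := μ) fun i => (hf i).aemeasurable)
    fun i => (hf i).comp (measurable_pi_apply i)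
  rw [this]
  exact Finset.prod_congr rfl fun i _ => (measurePreserving_eval μ i).lintegral_comp (hf i)

theorem measurable_ite_lt (p B : ℝ) :
    Measurable fun x : unitInterval => ENNReal.ofReal (if (x : ℝ) < p then B else 1) :=
  ENNReal.measurable_ofReal.comp (Measurable.ite
    (measurableSet_lt measurable_subtype_coe measurable_const) measurable_const measurable_const)

/-- The generating function of a Bernoulli variable is 1 + (B - 1)p, at most exp((B - 1)p). -/
theorem lintegral_ite_lt_le {p B : ℝ} (h0 : 0 ≤ p) (h1 : p ≤ 1) (hB : 0 ≤ B) :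
    ∫⁻ x : unitInterval, ENNReal.ofReal (if (x : ℝ) < p then B else 1) ≤
      ENNReal.ofReal (Real.exp ((B - 1) * p)) := by
  have hm : MeasurableSet {x : unitInterval | (x : ℝ) < p} :=
    measurableSet_lt measurable_subtype_coe measurable_const
  have hc : {x : unitInterval | (x : ℝ) < p}ᶜ = {x : unitInterval | p ≤ (x : ℝ)} := by
    ext x; simp
  rw [← lintegral_add_compl _ hm]
  have e1 : ∫⁻ x in {x : unitInterval | (x : ℝ) < p},
      ENNReal.ofReal (if (x : ℝ) < p then B else 1) = ENNReal.ofReal B * ENNReal.ofReal p := by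
    rw [setLIntegral_congr_fun hm (g := fun _ => ENNReal.ofReal B) fun x hx => by
      rw [if_pos (show (x : ℝ) < p from hx)], setLIntegral_const, volume_coe_lt h0 h1]
  have e2 : ∫⁻ x in {x : unitInterval | (x : ℝ) < p}ᶜ,
      ENNReal.ofReal (if (x : ℝ) < p then B else 1) = ENNReal.ofReal (1 - p) := by
    rw [setLIntegral_congr_fun hm.compl (g := fun _ => 1) fun x hx => by
      rw [if_neg (show ¬ (x : ℝ) < p from hx), ENNReal.ofReal_one], setLIntegral_const, one_mul,
      hc, volume_le_coe h0 h1]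
  rw [e1, e2, ← ENNReal.ofReal_mul hB, ← ENNReal.ofReal_add (by positivity) (by linarith)]
  refine ENNReal.ofReal_le_ofReal ?_
  linarith [Real.add_one_le_exp ((B - 1) * p)]

end Uniform

/-! ### What the median says about half of the samples. -/

section Median

variable {k : ℕ} (f : Fin k → ℕ)

/-- The sorted values from position k/2 on are at least the upper middle value, hence at least the
median; they make up at least half of all positions. -/
theorem le_two_mul_card_of_le_median {τ : ℝ} (hτ : τ ≤ median f) :
    k ≤ 2 * (Finset.univ.filter fun j => τ ≤ f j).card := by
  rcases Nat.eq_zero_or_pos k with hk | hk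
  · omega
  rw [median, dif_pos hk] at hτ
  have hmono := Tuple.monotone_sort f
  have hab : (f (Tuple.sort f ⟨(k - 1) / 2, by omega⟩) : ℝ) ≤ f (Tuple.sort f ⟨k / 2, by omega⟩) :=
    Nat.cast_le.2 (hmono (by simp only [Fin.mk_le_mk]; omega))
  have hle : ((Finset.Ici (⟨k / 2, by omega⟩ : Fin k)).map (Tuple.sort f).toEmbedding).card ≤
      (Finset.univ.filter fun j => τ ≤ f j).card := by
    refine Finset.card_le_card fun j hj => ?_
    obtain ⟨i, hi, rfl⟩ := Finset.mem_map.1 hj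
    have : (f (Tuple.sort f ⟨k / 2, by omega⟩) : ℝ) ≤ f (Tuple.sort f i) :=
      Nat.cast_le.2 (hmono (Finset.mem_Ici.1 hi))
    simp only [Finset.mem_filter, Finset.mem_univ, true_and, Equiv.coe_toEmbedding]
    linarith
  rw [Finset.card_map, Fin.card_Ici] at hle
  simp only at hle
  omega

/-- The lower middle value is below a + 1, hence at most a by integrality, and so are all values
sorted before it. -/
theorem le_two_mul_card_of_median_lt {a : ℕ} (hτ : median f < a + 1) :
    k ≤ 2 * (Finset.univ.filter fun j => f j ≤ a).card := by
  rcases Nat.eq_zero_or_pos k with hk | hk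
  · omega
  rw [median, dif_pos hk] at hτ
  have hmono := Tuple.monotone_sort f
  have hab : (f (Tuple.sort f ⟨(k - 1) / 2, by omega⟩) : ℝ) ≤ f (Tuple.sort f ⟨k / 2, by omega⟩) :=
    Nat.cast_le.2 (hmono (by simp only [Fin.mk_le_mk]; omega))
  have ha : f (Tuple.sort f ⟨(k - 1) / 2, by omega⟩) < a + 1 := by
    have : (f (Tuple.sort f ⟨(k - 1) / 2, by omega⟩) : ℝ) < a + 1 := by linarith
    exact_mod_cast this
  have hle : ((Finset.Iic (⟨(k - 1) / 2, by omega⟩ : Fin k)).map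
      (Tuple.sort f).toEmbedding).card ≤ (Finset.univ.filter fun j => f j ≤ a).card := by
    refine Finset.card_le_card fun j hj => ?_
    obtain ⟨i, hi, rfl⟩ := Finset.mem_map.1 hj
    have : f (Tuple.sort f i) ≤ f (Tuple.sort f ⟨(k - 1) / 2, by omega⟩) :=
      hmono (Finset.mem_Iic.1 hi)
    simp only [Finset.mem_filter, Finset.mem_univ, true_and, Equiv.coe_toEmbedding]
    omega
  rw [Finset.card_map, Fin.card_Iic] at hle
  simp only at hle
  omega

end Median

/-! ### The estimates mislead with probability exponentially small in k. -/

section Concentration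

variable {V : Type*} [Fintype V] {G : SimpleGraph V} {k : ℕ} {s : State V}

theorem pow_sampleCount (B : ℝ) (r : V → NodeCoins k) (v : V) (j : Fin k) :
    B ^ sampleCount G s r v j = ∏ u ∈ activeNbrs G s v,
      if (((r u).1 j : unitInterval) : ℝ) < s.p u then B else 1 := by
  classical
  rw [sampleCount_eq_sum, ← Finset.prod_pow_eq_pow_sum]
  refine Finset.prod_congr rfl fun u _ => ?_
  split_ifs <;> simp

theorem lintegral_prod_pow_sampleCount_le (hs : s.Dyadic) {B : ℝ} (hB : 0 ≤ B) (v : V)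
    (J : Finset (Fin k)) :
    ∫⁻ r : V → NodeCoins k, ∏ j ∈ J, ENNReal.ofReal (B ^ sampleCount G s r v j) ≤
      ENNReal.ofReal (Real.exp ((B - 1) * load G s s.p v)) ^ J.card := by
  have hp1 : ∀ u, s.p u ≤ 1 := fun u => (hs.le_half u).trans (by norm_num)
  have hm : ∀ u, Measurable fun c : NodeCoins k => ∏ j ∈ J,
      ENNReal.ofReal (if ((c.1 j : unitInterval) : ℝ) < s.p u then B else 1) := fun u =>
    Finset.measurable_prod _ fun j _ =>
      (measurable_ite_lt (s.p u) B).comp ((measurable_pi_apply j).comp measurable_fst)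
  calc ∫⁻ r : V → NodeCoins k, ∏ j ∈ J, ENNReal.ofReal (B ^ sampleCount G s r v j)
      = ∫⁻ r : V → NodeCoins k, ∏ u ∈ activeNbrs G s v, ∏ j ∈ J,
          ENNReal.ofReal (if (((r u).1 j : unitInterval) : ℝ) < s.p u then B else 1) := by
        refine lintegral_congr fun r => ?_
        rw [Finset.prod_comm]
        refine Finset.prod_congr rfl fun j _ => ?_
        rw [pow_sampleCount, ENNReal.ofReal_prod_of_nonneg]
        intro u _
        split_ifs <;> linarith
    _ = ∏ u ∈ activeNbrs G s v, ∫⁻ c : NodeCoins k, ∏ j ∈ J,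
          ENNReal.ofReal (if ((c.1 j : unitInterval) : ℝ) < s.p u then B else 1) :=
        lintegral_pi_prod (fun _ : V => (volume : Measure (NodeCoins k))) _ hm
    _ = ∏ u ∈ activeNbrs G s v, ∏ _j ∈ J, ∫⁻ x : unitInterval,
          ENNReal.ofReal (if (x : ℝ) < s.p u then B else 1) := by
        refine Finset.prod_congr rfl fun u _ => ?_
        rw [← lintegral_pi_prod (fun _ : Fin k => (volume : Measure unitInterval)) J
          fun _ => measurable_ite_lt (s.p u) B]
        exact (measurePreserving_fst (μ := (volume : Measure (Fin k → unitInterval)))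
          (ν := (volume : Measure unitInterval))).lintegral_comp
          (Finset.measurable_prod J fun j _ =>
            (measurable_ite_lt (s.p u) B).comp (measurable_pi_apply j))
    _ ≤ ∏ u ∈ activeNbrs G s v, ∏ _j ∈ J, ENNReal.ofReal (Real.exp ((B - 1) * s.p u)) :=
        Finset.prod_le_prod' fun u _ => Finset.prod_le_prod' fun j _ =>
          lintegral_ite_lt_le (hs.pos u).le (hp1 u) hB
    _ = _ := by
        rw [Finset.prod_comm, Finset.prod_const, load, Finset.mul_sum, Real.exp_sum,
          ENNReal.ofReal_prod_of_nonneg fun _ _ => (Real.exp_pos _).le]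

/-- A Chernoff bound makes `Q` hold in one repetition with probability at most 1/64. For a fixed set
of at least k/2 repetitions independence gives 8^(-k), and there are at most 2^k such sets. -/
theorem volume_half_le (hs : s.Dyadic) {B c : ℝ} (hB : 0 ≤ B) (hc : 0 ≤ c) (v : V)
    (Q : ℕ → Prop) [DecidablePred Q] (hQ : ∀ n, Q n → 1 ≤ c * B ^ n)
    (hsmall : c * Real.exp ((B - 1) * load G s s.p v) ≤ 1 / 64) :
    volume {r : V → NodeCoins k |
      k ≤ 2 * (Finset.univ.filter fun j => Q (sampleCount G s r v j)).card} ≤ 4⁻¹ ^ k := by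
  classical
  have hX : ∀ j, Measurable fun r : V → NodeCoins k =>
      ENNReal.ofReal c * ENNReal.ofReal (B ^ sampleCount G s r v j) := by
    intro j
    refine (ENNReal.measurable_ofReal.comp ?_).const_mul _
    simp only [pow_sampleCount]
    refine Finset.measurable_prod _ fun u _ => Measurable.ite ?_ measurable_const measurable_const
    exact measurableSet_lt (measurable_sample measurable_id u j) measurable_const
  set 𝒥 : Finset (Finset (Fin k)) := Finset.univ.filter fun J => k ≤ 2 * J.card with h𝒥
  have h1 : ∀ r : V → NodeCoins k,
      {r : V → NodeCoins k | k ≤ 2 * (Finset.univ.filter fun j =>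
        Q (sampleCount G s r v j)).card}.indicator 1 r ≤
      ∑ J ∈ 𝒥, ∏ j ∈ J, (ENNReal.ofReal c * ENNReal.ofReal (B ^ sampleCount G s r v j)) := by
    intro r
    refine Set.indicator_apply_le' (fun hr => ?_) fun _ => zero_le
    refine le_trans ?_ (Finset.single_le_sum (fun _ _ => zero_le)
      (show (Finset.univ.filter fun j => Q (sampleCount G s r v j)) ∈ 𝒥 by simpa [h𝒥] using hr))
    refine Finset.one_le_prod' fun j hj => ?_
    rw [← ENNReal.ofReal_mul hc, ← ENNReal.ofReal_one]
    exact ENNReal.ofReal_le_ofReal (hQ _ (Finset.mem_filter.1 hj).2)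
  have h2 : ∀ J ∈ 𝒥, ∫⁻ r : V → NodeCoins k, ∏ j ∈ J,
      (ENNReal.ofReal c * ENNReal.ofReal (B ^ sampleCount G s r v j)) ≤ 8⁻¹ ^ k := by
    intro J hJ
    have hJ' : k ≤ 2 * J.card := by simpa [h𝒥] using hJ
    simp only [Finset.prod_mul_distrib, Finset.prod_const]
    rw [lintegral_const_mul' _ _ (by finiteness)]
    calc _ ≤ ENNReal.ofReal c ^ J.card *
          ENNReal.ofReal (Real.exp ((B - 1) * load G s s.p v)) ^ J.card := by
          gcongr
          exact lintegral_prod_pow_sampleCount_le hs hB v J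
      _ = ENNReal.ofReal (c * Real.exp ((B - 1) * load G s s.p v)) ^ J.card := by
          rw [← mul_pow, ENNReal.ofReal_mul hc]
      _ ≤ ENNReal.ofReal (1 / 64) ^ J.card := by gcongr
      _ = (8⁻¹ : ℝ≥0∞) ^ (2 * J.card) := by
          rw [pow_mul]
          congr 1
          rw [one_div, ENNReal.ofReal_inv_of_pos (by norm_num), ← ENNReal.inv_pow]
          congr 1
          norm_num
      _ ≤ 8⁻¹ ^ k := pow_le_pow_right_of_le_one' (by norm_num) hJ'
  have hmeas : MeasurableSet {r : V → NodeCoins k |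
      k ≤ 2 * (Finset.univ.filter fun j => Q (sampleCount G s r v j)).card} := by
    have : Measurable fun r : V → NodeCoins k => fun j => sampleCount G s r v j := by
      refine measurable_pi_iff.2 fun j => ?_
      simp only [sampleCount_eq_sum]
      exact Finset.measurable_sum _ fun u _ => Measurable.ite
        (measurableSet_lt (measurable_sample measurable_id u j) measurable_const)
        measurable_const measurable_const
    exact this (MeasurableSet.of_discrete (s := {x : Fin k → ℕ |
      k ≤ 2 * (Finset.univ.filter fun j => Q (x j)).card}))
  rw [← lintegral_indicator_one hmeas]
  calc _ ≤ ∫⁻ r : V → NodeCoins k, ∑ J ∈ 𝒥, ∏ j ∈ J,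
        (ENNReal.ofReal c * ENNReal.ofReal (B ^ sampleCount G s r v j)) := lintegral_mono h1
    _ = ∑ J ∈ 𝒥, ∫⁻ r : V → NodeCoins k, ∏ j ∈ J,
        (ENNReal.ofReal c * ENNReal.ofReal (B ^ sampleCount G s r v j)) :=
        lintegral_finsetSum _ fun J _ => Finset.measurable_prod _ fun j _ => hX j
    _ ≤ ∑ J ∈ 𝒥, 8⁻¹ ^ k := Finset.sum_le_sum h2
    _ ≤ 2 ^ k * 8⁻¹ ^ k := by
        rw [Finset.sum_const, nsmul_eq_mul]
        gcongr
        have : 𝒥.card ≤ 2 ^ k := by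
          refine (Finset.card_le_univ _).trans ?_
          simp
        exact_mod_cast this
    _ = 4⁻¹ ^ k := by
        rw [← mul_pow]
        congr 1
        rw [← ENNReal.toReal_eq_toReal_iff' (by finiteness) (by finiteness)]
        norm_num

/-- The base 128 works because e^(127/200) ≤ 2, so the Chernoff bound is at most (128/2)^(-τ) ≤
1/64. -/
theorem volume_le_estimate_le (hs : s.Dyadic) {τ : ℝ} (hτ : 1 ≤ τ) {v : V}
    (hl : load G s s.p v < τ / 200) :
    volume {r : V → NodeCoins k | τ ≤ estimate G s r v} ≤ 4⁻¹ ^ k := by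
  classical
  refine (measure_mono fun r hr => le_two_mul_card_of_le_median _ hr).trans
    (volume_half_le hs (B := 128) (c := 128 ^ (-τ)) (by norm_num) (by positivity) v
      (fun n => τ ≤ n) (fun n hn => ?_) ?_)
  · rw [← Real.rpow_natCast, ← Real.rpow_add (by norm_num)]
    exact Real.one_le_rpow (by norm_num) (by linarith)
  · have h2 : Real.exp (127 / 200) ≤ 2 := by
      rw [← Real.le_log_iff_exp_le two_pos]
      linarith [Real.log_two_gt_d9]
    calc (128 : ℝ) ^ (-τ) * Real.exp ((128 - 1) * load G s s.p v)
        ≤ 128 ^ (-τ) * Real.exp (127 / 200 * τ) :=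
          mul_le_mul_of_nonneg_left (Real.exp_le_exp.2 (by linarith)) (by positivity)
      _ = 128 ^ (-τ) * Real.exp (127 / 200) ^ τ := by rw [Real.exp_mul]
      _ ≤ 128 ^ (-τ) * 2 ^ τ := by gcongr
      _ = 64 ^ (-τ) := by
          rw [show (128 : ℝ) = 64 * 2 by norm_num, Real.mul_rpow (by norm_num) (by norm_num),
            mul_assoc, ← Real.rpow_add two_pos]
          simp
      _ ≤ 64 ^ (-1 : ℝ) := Real.rpow_le_rpow_of_exponent_le (by norm_num) (by linarith)
      _ = 1 / 64 := by rw [Real.rpow_neg_one]; norm_num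

/-- An estimate below 2 forces half of the counts to be at most 1. With base 1/4 each such count has
probability at most 4·e^(-7) ≤ 4/256 = 1/64. -/
theorem volume_estimate_lt_le (hs : s.Dyadic) {v : V} (hl : 10 < load G s s.p v) :
    volume {r : V → NodeCoins k | estimate G s r v < 2} ≤ 4⁻¹ ^ k := by
  classical
  refine (measure_mono fun r hr => le_two_mul_card_of_median_lt (a := 1)
    (sampleCount G s r v) ?_).trans (volume_half_le hs (B := 1 / 4) (c := 4) (by norm_num) (by norm_num) v
      (fun n => n ≤ 1) (fun n hn => ?_) ?_)
  · have : estimate G s r v < 2 := hr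
    rw [estimate] at this
    norm_num
    exact this
  · interval_cases n <;> norm_num
  · have h : Real.exp ((1 / 4 - 1) * load G s s.p v) ≤ Real.exp (-7) :=
      Real.exp_le_exp.2 (by linarith)
    have h7 : (256 : ℝ) ≤ Real.exp 7 := by
      have h1 : Real.exp 7 = Real.exp 1 ^ 7 := by rw [← Real.exp_nat_mul]; norm_num
      have h2 : (2.7 : ℝ) ≤ Real.exp 1 := by linarith [Real.exp_one_gt_d9]
      rw [h1]
      calc (256 : ℝ) ≤ 2.7 ^ 7 := by norm_num
        _ ≤ _ := by gcongr
    have h8 : Real.exp (-7) ≤ 1 / 256 := by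
      rw [Real.exp_neg, ← one_div]
      exact one_div_le_one_div_of_le (by norm_num) h7
    linarith

variable {R : ℕ} {θ : ℝ} {t : ℕ}

/-- Linearity of expectation suffices: the estimates of different neighbors need not be independent.
-/
theorem lintegral_badWeight_le (hs : s.Dyadic) (v : V) :
    ∫⁻ r : V → NodeCoins k, ENNReal.ofReal (badWeight G R θ t s v r) ≤
      4⁻¹ ^ k * ENNReal.ofReal (load G s s.p v) := by
  classical
  have hmeas : ∀ x, MeasurableSet {r : V → NodeCoins k |
      x ∉ halving G R θ t s r ∧ 10 < load G s s.p x} := fun x =>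
    (measurableSet_halving R θ t (measurableState_const s) measurable_id x).compl.inter (.const _)
  have h1 : ∀ r : V → NodeCoins k, ENNReal.ofReal (badWeight G R θ t s v r) =
      ∑ x ∈ activeNbrs G s v, {r : V → NodeCoins k |
        x ∉ halving G R θ t s r ∧ 10 < load G s s.p x}.indicator
          (fun _ => ENNReal.ofReal (s.p x)) r := by
    intro r
    rw [badWeight, ENNReal.ofReal_sum_of_nonneg]
    · refine Finset.sum_congr rfl fun x _ => ?_
      rw [Set.indicator_apply, apply_ite ENNReal.ofReal, ENNReal.ofReal_zero]
      rfl
    · intro x _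
      split_ifs
      · exact (hs.pos x).le
      · exact le_rfl
  simp only [h1]
  rw [lintegral_finsetSum _ fun x _ => measurable_const.indicator (hmeas x), load,
    ENNReal.ofReal_sum_of_nonneg fun u _ => (hs.pos u).le, Finset.mul_sum]
  refine Finset.sum_le_sum fun x _ => ?_
  rw [lintegral_indicator_const (hmeas x), mul_comm]
  gcongr
  by_cases hx : 10 < load G s s.p x
  · refine (measure_mono fun r hr => ?_).trans (volume_estimate_lt_le hs hx)
    exact not_le.1 fun h => hr.1 (Or.inl h)
  · simp [hx]

/-- The four alternatives cost 1 + 18 + 1 + 1 times 4^(-k); the 18 is Markov's inequality for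
`badWeight`. -/
theorem volume_misled_le (hs : s.Dyadic) (hθ : 1 ≤ θ) (v : V) :
    volume {r : V → NodeCoins k | Misled G R θ t s v r} ≤ 21 * 4⁻¹ ^ k := by
  have h1 : volume {r : V → NodeCoins k | v ∉ halving G R θ t s r ∧ 10 < load G s s.p v} ≤
      4⁻¹ ^ k := by
    by_cases hx : 10 < load G s s.p v
    · refine (measure_mono fun r hr => ?_).trans (volume_estimate_lt_le hs hx)
      exact not_le.1 fun h => hr.1 (Or.inl h)
    · simp [hx]
  have h2 : volume {r : V → NodeCoins k | 0 < load G s s.p v ∧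
      load G s s.p v / 18 ≤ badWeight G R θ t s v r} ≤ 18 * 4⁻¹ ^ k := by
    by_cases hx : 0 < load G s s.p v
    · have hl0 : ENNReal.ofReal (load G s s.p v / 18) ≠ 0 := by
        simpa using by positivity
      refine (measure_mono (t := {r | ENNReal.ofReal (load G s s.p v / 18) ≤
        ENNReal.ofReal (badWeight G R θ t s v r)}) fun r hr =>
          ENNReal.ofReal_le_ofReal hr.2).trans ?_
      refine (meas_ge_le_lintegral_div ((ENNReal.measurable_ofReal.comp (measurable_badWeight R θ t
        (measurableState_const s) measurable_id v)).aemeasurable) hl0 (by finiteness)).trans ?_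
      refine ENNReal.div_le_of_le_mul ((lintegral_badWeight_le hs v).trans (le_of_eq ?_))
      rw [mul_comm 18, mul_assoc]
      congr 1
      rw [show (18 : ℝ≥0∞) = ENNReal.ofReal 18 by norm_num, ← ENNReal.ofReal_mul (by norm_num)]
      congr 1
      ring
    · simp [hx]
  have h3 : volume {r : V → NodeCoins k | 2 ≤ estimate G s r v ∧ load G s s.p v < 2 / 200} ≤
      4⁻¹ ^ k := by
    by_cases hx : load G s s.p v < 2 / 200
    · exact (measure_mono fun r hr => hr.1).trans (volume_le_estimate_le hs one_le_two hx)
    · simp [hx]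
  have h4 : volume {r : V → NodeCoins k | θ ≤ estimate G s r v ∧ load G s s.p v < θ / 200} ≤
      4⁻¹ ^ k := by
    by_cases hx : load G s s.p v < θ / 200
    · exact (measure_mono fun r hr => hr.1).trans (volume_le_estimate_le hs hθ hx)
    · simp [hx]
  calc volume {r : V → NodeCoins k | Misled G R θ t s v r}
      ≤ _ + (_ + (_ + _)) := (measure_union_le _ _).trans (add_le_add le_rfl
        ((measure_union_le _ _).trans (add_le_add le_rfl (measure_union_le _ _))))
    _ ≤ 4⁻¹ ^ k + (18 * 4⁻¹ ^ k + (4⁻¹ ^ k + 4⁻¹ ^ k)) :=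
        add_le_add h1 (add_le_add h2 (add_le_add h3 h4))
    _ = 21 * 4⁻¹ ^ k := by ring

end Concentration

/-! ### Isolated marks, and contraction of the expected potential. -/

section Marking

variable {V : Type*} [Fintype V]

theorem exp_neg_two_mul_le {q : ℝ} (h0 : 0 ≤ q) (h1 : q ≤ 1 / 2) : Real.exp (-(2 * q)) ≤ 1 - q := by
  rw [Real.exp_neg, inv_le_comm₀ (Real.exp_pos _) (by linarith)]
  refine le_trans ?_ (Real.add_one_le_exp (2 * q))
  rw [inv_le_iff_one_le_mul₀ (by linarith)]
  nlinarith

theorem exists_subset_sum_le {ι : Type*} {q : ι → ℝ} {b c : ℝ} (hq : ∀ i, q i ≤ b)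
    (hc : 0 < c) (H : Finset ι) (h : c ≤ ∑ i ∈ H, q i) :
    ∃ H' ⊆ H, c ≤ ∑ i ∈ H', q i ∧ ∑ i ∈ H', q i ≤ b + c := by
  classical
  induction H using Finset.induction_on with
  | empty => simp at h; linarith
  | insert a H ha ih =>
    by_cases hH : c ≤ ∑ i ∈ H, q i
    · obtain ⟨H', h1, h2⟩ := ih hH
      exact ⟨H', h1.trans (Finset.subset_insert a H), h2⟩
    · refine ⟨insert a H, subset_rfl, h, ?_⟩
      rw [Finset.sum_insert ha]
      linarith [hq a]

/-- If the marking probabilities in `H` are large in total and the total marking probabilities of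
the neighborhoods of nodes in `H` are bounded, then with constant probability some node of `H` is
marked and has no marked neighbor. -/
theorem le_volume_exists_isolated {q : V → ℝ} (h0 : ∀ u, 0 ≤ q u) (h1 : ∀ u, q u ≤ 1 / 2)
    {nb : V → Finset V} {H : Finset V} (hself : ∀ x ∈ H, x ∉ nb x)
    (hnb : ∀ x ∈ H, ∑ w ∈ nb x, q w ≤ 20) {c : ℝ} (hc : 0 < c) (hc1 : c ≤ 1 / 2)
    (hH : c ≤ ∑ x ∈ H, q x) :
    ENNReal.ofReal (c * Real.exp (-42)) ≤
      volume {y : V → unitInterval | ∃ x ∈ H, (y x : ℝ) < q x ∧ ∀ w ∈ nb x, q w ≤ (y w : ℝ)} := by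
  classical
  -- Trimming `H` to total weight at most 1/2 + c ≤ 1 keeps the chance that all its other members
  -- are unmarked bounded below.
  obtain ⟨H', hsub, hcH, hH1⟩ := exists_subset_sum_le h1 hc H hH
  -- The box `A x` asks that `x` be marked while the rest of `H'` and all of `nb x` are unmarked.
  -- The condition on `H'` makes the boxes disjoint, so their probabilities add up.
  set A : V → V → Set unitInterval := fun x w =>
    if w = x then {y | (y : ℝ) < q x} else if w ∈ H' ∪ nb x then {y | q w ≤ (y : ℝ)} else Set.univ
    with hA
  have hAm : ∀ x w, MeasurableSet (A x w) := by
    intro x w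
    simp only [hA]
    split_ifs
    · exact measurableSet_lt measurable_subtype_coe measurable_const
    · exact measurableSet_le measurable_const measurable_subtype_coe
    · exact MeasurableSet.univ
  have hvol : ∀ x ∈ H', ENNReal.ofReal (q x * Real.exp (-42)) ≤
      volume (Set.univ.pi (A x)) := by
    intro x hx
    rw [volume_pi_pi]
    have hw : ∀ w, ENNReal.ofReal ((if w = x then q x else 1) *
        (if w ∈ H' ∪ nb x then Real.exp (-(2 * q w)) else 1)) ≤ volume (A x w) := by
      intro w
      simp only [hA]
      by_cases hwx : w = x
      · subst hwx
        rw [if_pos rfl, if_pos rfl, volume_coe_lt (h0 w) ((h1 w).trans (by norm_num))]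
        refine ENNReal.ofReal_le_ofReal (mul_le_of_le_one_right (h0 w) ?_)
        split_ifs
        · exact Real.exp_le_one_iff.2 (by linarith [h0 w])
        · exact le_rfl
      · rw [if_neg hwx, if_neg hwx, one_mul]
        split_ifs
        · rw [volume_le_coe (h0 w) ((h1 w).trans (by norm_num))]
          exact ENNReal.ofReal_le_ofReal (exp_neg_two_mul_le (h0 w) (h1 w))
        · simp
    refine le_trans ?_ (Finset.prod_le_prod' fun w _ => hw w)
    rw [← ENNReal.ofReal_prod_of_nonneg, Finset.prod_mul_distrib, Finset.prod_ite_eq' Finset.univ x,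
      if_pos (Finset.mem_univ x), Finset.prod_ite_mem, Finset.univ_inter, ← Real.exp_sum]
    · refine ENNReal.ofReal_le_ofReal (mul_le_mul_of_nonneg_left (Real.exp_le_exp.2 ?_) (h0 x))
      rw [Finset.sum_neg_distrib, ← Finset.mul_sum]
      have hle : ∑ w ∈ H' ∪ nb x, q w ≤ ∑ w ∈ H', q w + ∑ w ∈ nb x, q w := by
        rw [← Finset.sum_union_inter]
        linarith [Finset.sum_nonneg fun w (_ : w ∈ H' ∩ nb x) => h0 w]
      -- The exponent 42 is 2·(1 + 20).
      linarith [hnb x (hsub hx)]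
    · intro w _
      have := h0 x
      split_ifs <;> positivity
  have hdisj : Set.PairwiseDisjoint (H' : Set V) fun x => Set.univ.pi (A x) := by
    intro x hx x' hx' hne
    refine Set.disjoint_left.2 fun y hy hy' => ?_
    have e1 := hy x (Set.mem_univ x)
    have e2 := hy' x (Set.mem_univ x)
    simp only [hA, if_true] at e1
    simp only [hA] at e2
    rw [if_neg hne, if_pos (Finset.mem_union_left _ hx)] at e2
    exact absurd (show (y x : ℝ) < q x from e1) (not_lt.2 e2)
  calc ENNReal.ofReal (c * Real.exp (-42))
      ≤ ENNReal.ofReal (∑ x ∈ H', q x * Real.exp (-42)) := by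
        rw [← Finset.sum_mul]
        exact ENNReal.ofReal_le_ofReal (mul_le_mul_of_nonneg_right hcH (Real.exp_pos _).le)
    _ = ∑ x ∈ H', ENNReal.ofReal (q x * Real.exp (-42)) :=
        ENNReal.ofReal_sum_of_nonneg fun x _ => mul_nonneg (h0 x) (Real.exp_pos _).le
    _ ≤ ∑ x ∈ H', volume (Set.univ.pi (A x)) := Finset.sum_le_sum hvol
    _ = volume (⋃ x ∈ H', Set.univ.pi (A x)) :=
        (measure_biUnion_finset hdisj fun x _ => MeasurableSet.univ_pi (hAm x)).symm
    _ ≤ _ := by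
        refine measure_mono (Set.iUnion₂_subset fun x hx y hy => ⟨x, hsub hx, ?_, fun w hw => ?_⟩)
        · have := hy x (Set.mem_univ x)
          simp only [hA, if_true] at this
          exact this
        · have := hy w (Set.mem_univ w)
          have hne : w ≠ x := by
            rintro rfl
            exact hself w (hsub hx) hw
          simp only [hA] at this
          rwa [if_neg hne, if_pos (Finset.mem_union_right _ hw)] at this

variable {G : SimpleGraph V} {k : ℕ} {s : State V} {R : ℕ} {θ : ℝ} {t : ℕ}

theorem goodNbrs_congr {r r' : V → NodeCoins k} (h : ∀ u, (r u).1 = (r' u).1) (v : V) :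
    goodNbrs G R θ t s v r = goodNbrs G R θ t s v r' := by
  have he : ∀ x, estimate G s r x = estimate G s r' x := by
    intro x
    unfold estimate
    congr 1
    funext j
    simp only [sampleCount, h]
  have hh : halving G R θ t s r = halving G R θ t s r' := by
    simp only [halving, nextStalling, he]
  ext x
  simp only [goodNbrs, Finset.mem_filter, hh]

/-- With the sampling numbers `a` fixed, the good nodes are determined and only the marking numbers
are random. The 0 is a placeholder, since `Golden` ignores the marking numbers. A load of at most 10
bounds the neighbors' marking probabilities by 20 in total. -/
theorem le_volume_localJoin (hs : s.Dyadic) {v : V} (a : V → Fin k → unitInterval)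
    (hg : Golden G R θ t s v fun u => (a u, 0)) :
    ENNReal.ofReal (1 / 18000 * Real.exp (-42)) ≤
      volume {y : V → unitInterval | LocalJoin G R θ t s (fun u => (a u, y u)) v} := by
  have h1 : ∀ u, markBound s u ≤ 1 / 2 := fun u => min_le_right _ _
  refine (le_volume_exists_isolated (fun u => (hs.markBound_pos u).le) h1
    (nb := activeNbrs G s) (fun x _ => ?_) (fun x hx => ?_) (by norm_num) (by norm_num) hg).trans
    (measure_mono ?_)
  · simp [activeNbrs]
  · have hl : load G s s.p x ≤ 10 := by
      simp only [goodNbrs, Finset.mem_filter] at hx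
      exact hx.2.2.2.2
    calc ∑ w ∈ activeNbrs G s x, markBound s w ≤ ∑ w ∈ activeNbrs G s x, 2 * s.p w :=
          Finset.sum_le_sum fun w _ => min_le_left _ _
      _ ≤ 20 := by rw [← Finset.mul_sum]; unfold load at hl; linarith
  · rintro y ⟨x, hx, hlt, hw⟩
    rw [goodNbrs_congr (r := fun u => (a u, (0 : unitInterval))) (r' := fun u => (a u, y u))
      fun _ => rfl] at hx
    simp only [goodNbrs, Finset.mem_filter, Finset.mem_univ, true_and] at hx
    refine ⟨x, hx.1, hx.2.1, hx.2.2.1, hlt, fun w hxw hact => hw w ?_⟩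
    simp only [activeNbrs, Finset.mem_filter, Finset.mem_univ, true_and]
    exact ⟨hxw, hact⟩

theorem lintegral_nodeCoins {F : (V → NodeCoins k) → ℝ≥0∞} (hF : Measurable F) :
    ∫⁻ r, F r = ∫⁻ a : V → Fin k → unitInterval, ∫⁻ y : V → unitInterval,
      F fun u => (a u, y u) := by
  have h := volume_measurePreserving_arrowProdEquivProdArrow (Fin k → unitInterval) unitInterval V
  rw [← (h.symm _).lintegral_comp hF, Measure.volume_eq_prod]
  exact lintegral_prod _ (hF.comp (h.symm _).measurable).aemeasurable

open Classical in
theorem lintegral_golden_le (hs : s.Dyadic) {ε l : ℝ} (hl : 2⁻¹ ^ ε ≤ l)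
    (hl' : 32 ^ ε * (1 - 1 / 18000 * Real.exp (-42)) ≤ l) (v : V) :
    ∫⁻ r : V → NodeCoins k, (if Golden G R θ t s v r then
        if LocalJoin G R θ t s r v then 0 else ENNReal.ofReal (32 ^ ε)
      else ENNReal.ofReal (2⁻¹ ^ ε)) ≤ ENNReal.ofReal l := by
  have hms := measurableState_const (Ω := V → NodeCoins k) s
  have hG : MeasurableSet {r : V → NodeCoins k | Golden G R θ t s v r} :=
    measurableSet_golden R θ t hms measurable_id v
  have hJ : MeasurableSet {r : V → NodeCoins k | LocalJoin G R θ t s r v} :=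
    measurableSet_localJoin R θ t hms measurable_id v
  rw [lintegral_nodeCoins (Measurable.ite hG
    (Measurable.ite hJ measurable_const measurable_const) measurable_const)]
  have hinner : ∀ a : V → Fin k → unitInterval, ∫⁻ y : V → unitInterval,
      (if Golden G R θ t s v (fun u => (a u, y u)) then
        if LocalJoin G R θ t s (fun u => (a u, y u)) v then 0 else ENNReal.ofReal (32 ^ ε)
      else ENNReal.ofReal (2⁻¹ ^ ε)) ≤ ENNReal.ofReal l := by
    intro a
    have hcongr : ∀ y : V → unitInterval, Golden G R θ t s v (fun u => (a u, y u)) ↔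
        Golden G R θ t s v (fun u => (a u, 0)) := by
      intro y
      simp only [Golden]
      rw [goodNbrs_congr (r := fun u => (a u, y u)) (r' := fun u => (a u, (0 : unitInterval)))
        fun _ => rfl]
    by_cases hg : Golden G R θ t s v (fun u => (a u, 0))
    · simp only [hcongr, hg, if_true]
      have hm : MeasurableSet {y : V → unitInterval |
          LocalJoin G R θ t s (fun u => (a u, y u)) v} :=
        measurableSet_localJoin R θ t (measurableState_const s)
          (r := fun (y : V → unitInterval) u => (a u, y u))
          (measurable_pi_iff.2 fun u => measurable_const.prodMk (measurable_pi_apply u)) v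
      calc _ = ∫⁻ y : V → unitInterval, {y : V → unitInterval |
            LocalJoin G R θ t s (fun u => (a u, y u)) v}ᶜ.indicator
              (fun _ => ENNReal.ofReal (32 ^ ε)) y := by
            refine lintegral_congr fun y => ?_
            rw [Set.indicator_apply]
            by_cases h : LocalJoin G R θ t s (fun u => (a u, y u)) v
            · rw [if_pos h, if_neg fun h' => h' h]
            · rw [if_neg h, if_pos (show y ∈ {y : V → unitInterval |
                LocalJoin G R θ t s (fun u => (a u, y u)) v}ᶜ from h)]
        _ = ENNReal.ofReal (32 ^ ε) * (1 - volume {y : V → unitInterval |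
            LocalJoin G R θ t s (fun u => (a u, y u)) v}) := by
            rw [lintegral_indicator_const hm.compl, prob_compl_eq_one_sub hm]
        _ ≤ ENNReal.ofReal (32 ^ ε) *
            (ENNReal.ofReal 1 - ENNReal.ofReal (1 / 18000 * Real.exp (-42))) := by
            rw [ENNReal.ofReal_one]
            gcongr
            exact le_volume_localJoin hs a hg
        _ = ENNReal.ofReal (32 ^ ε * (1 - 1 / 18000 * Real.exp (-42))) := by
            rw [← ENNReal.ofReal_sub _ (by positivity), ← ENNReal.ofReal_mul (by positivity)]
        _ ≤ ENNReal.ofReal l := ENNReal.ofReal_le_ofReal hl'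
    · simp only [hcongr, hg, if_false, lintegral_const, measure_univ, mul_one]
      exact ENNReal.ofReal_le_ofReal hl
  refine (lintegral_mono hinner).trans ?_
  simp

/-- The error term is growth times probability of a misled iteration: 32·2^k · 21·4^(-k) =
672·2^(-k). -/
theorem lintegral_nextPotential_le (ha : Admissible R θ k) (hs : s.Dyadic) {ε l : ℝ} (hε : 0 < ε)
    (hε1 : ε ≤ 1) (hl : 2⁻¹ ^ ε ≤ l) (hl' : 32 ^ ε * (1 - 1 / 18000 * Real.exp (-42)) ≤ l)
    (v : V) :
    ∫⁻ r : V → NodeCoins k, nextPotential G R θ ε t s v r ≤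
      (ENNReal.ofReal l + 672 * 2⁻¹ ^ k) * potential G R ε t s v := by
  classical
  have hms := measurableState_const (Ω := V → NodeCoins k) s
  have hM : MeasurableSet {r : V → NodeCoins k | Misled G R θ t s v r} := by
    have he := measurable_estimate (G := G) hms measurable_id v
    exact ((measurableSet_halving R θ t hms measurable_id v).compl.inter (.const _)).union
      ((MeasurableSet.inter (.const _) (measurableSet_le measurable_const
        (measurable_badWeight R θ t hms measurable_id v))).union
      (((measurableSet_le measurable_const he).inter (.const _)).union
      ((measurableSet_le measurable_const he).inter (.const _))))
  have hpot : potential G R ε t s v ≠ ∞ := by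
    unfold potential
    split_ifs <;> simp
  refine (lintegral_mono (nextPotential_le ha hs hε hε1 v)).trans ?_
  rw [lintegral_const_mul' _ _ hpot, mul_comm]
  refine mul_le_mul_left ?_ _
  rw [lintegral_add_right _ (Measurable.ite hM measurable_const measurable_const)]
  refine add_le_add (lintegral_golden_le hs hl hl' v) ?_
  calc ∫⁻ r : V → NodeCoins k, (if Misled G R θ t s v r then (32 * 2 ^ k : ℝ≥0∞) else 0)
      = ∫⁻ r, {r : V → NodeCoins k | Misled G R θ t s v r}.indicator
          (fun _ => (32 * 2 ^ k : ℝ≥0∞)) r := by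
        refine lintegral_congr fun r => ?_
        rw [Set.indicator_apply]
        rfl
    _ = 32 * 2 ^ k * volume {r : V → NodeCoins k | Misled G R θ t s v r} :=
        lintegral_indicator_const hM _
    _ ≤ 32 * 2 ^ k * (21 * 4⁻¹ ^ k) := by
        gcongr
        exact volume_misled_le hs ha.one_le_θ v
    _ = 672 * (2 * 4⁻¹) ^ k := by rw [mul_pow]; ring
    _ = 672 * 2⁻¹ ^ k := by
        congr 2
        rw [← ENNReal.toReal_eq_toReal_iff' (by finiteness) (by finiteness)]
        norm_num

end Marking

/-! ### Product formulas for functions of disjoint blocks of coordinates. -/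

section BlockIndependence

variable {ι : Type*} [Fintype ι] {X : ι → Type*} [∀ i, MeasurableSpace (X i)]
  {μ : ∀ i, Measure (X i)} [∀ i, IsProbabilityMeasure (μ i)]

/-- Integrating out the coordinates in `D` turns `f` into a constant and leaves `g` untouched;
taking g = 1 identifies the constant as the integral of `f`. -/
theorem lintegral_mul_of_dependsOn {f g : (∀ i, X i) → ℝ≥0∞} (hf : Measurable f)
    (hg : Measurable g) {D : Set ι} (hfD : DependsOn f D) (hgD : DependsOn g Dᶜ) :
    ∫⁻ x, f x * g x ∂Measure.pi μ = (∫⁻ x, f x ∂Measure.pi μ) * ∫⁻ x, g x ∂Measure.pi μ := by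
  classical
  rcases isEmpty_or_nonempty (∀ i, X i) with h | ⟨⟨x₀⟩⟩
  · simp [lintegral_of_isEmpty]
  set c := lmarginal μ D.toFinset f x₀ with hc
  have key : ∀ g : (∀ i, X i) → ℝ≥0∞, Measurable g → DependsOn g Dᶜ →
      ∫⁻ x, f x * g x ∂Measure.pi μ = c * ∫⁻ x, g x ∂Measure.pi μ := by
    intro g hg hgD
    rw [← lintegral_const_mul _ hg]
    refine lintegral_eq_of_lmarginal_eq D.toFinset (hf.mul hg) (hg.const_mul c) ?_
    funext x
    have hgx : ∀ y, g (Function.updateFinset x D.toFinset y) = g x := by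
      intro y
      refine hgD fun i hi => ?_
      have hi' : i ∉ D.toFinset := fun h => hi (Set.mem_toFinset.1 h)
      simp [Function.updateFinset_def, hi']
    have hfx : ∀ y, f (Function.updateFinset x D.toFinset y) =
        f (Function.updateFinset x₀ D.toFinset y) := by
      intro y
      refine hfD fun i hi => ?_
      have hi' : i ∈ D.toFinset := Set.mem_toFinset.2 hi
      simp [Function.updateFinset_def, hi']
    simp only [lmarginal, hgx, hfx]
    have hm : Measurable fun y : ∀ i : D.toFinset, X i =>
        f (Function.updateFinset x₀ D.toFinset y) := hf.comp measurable_updateFinset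
    rw [lintegral_mul_const _ hm]
    simp [hc, lmarginal]
  have h1 := key (fun _ => 1) measurable_const fun _ _ _ => rfl
  simp only [mul_one, lintegral_const, measure_univ] at h1
  rw [key g hg hgD, h1]

theorem lintegral_prod_of_dependsOn {κ : Type*} {f : κ → (∀ i, X i) → ℝ≥0∞}
    (hf : ∀ a, Measurable (f a)) {D : κ → Set ι} (hfD : ∀ a, DependsOn (f a) (D a)) (S : Finset κ)
    (hS : (S : Set κ).PairwiseDisjoint D) :
    ∫⁻ x, ∏ a ∈ S, f a x ∂Measure.pi μ = ∏ a ∈ S, ∫⁻ x, f a x ∂Measure.pi μ := by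
  classical
  induction S using Finset.induction_on with
  | empty => simp
  | insert a S ha ih =>
    simp only [Finset.prod_insert ha]
    rw [lintegral_mul_of_dependsOn (hf a) (Finset.measurable_prod S fun b _ => hf b) (hfD a),
      ih (hS.subset (by simp))]
    intro x y hxy
    refine Finset.prod_congr rfl fun b hb => hfD b fun i hi => hxy i fun hia => ?_
    have hne : a ≠ b := by rintro rfl; exact ha hb
    exact Set.disjoint_left.1 (hS (by simp) (by simp [hb]) hne) hia hi

end BlockIndependence

/-! ### Decay of products of potentials over many iterations. -/

section Evolution

variable {V : Type*} {G : SimpleGraph V} {k : ℕ} {R : ℕ} {θ ε : ℝ}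

open Classical in
/-- The random numbers of one iteration that agree with `r` on `A` and with `ρ` elsewhere. -/
noncomputable def mix (A : Set V) (r ρ : V → NodeCoins k) : V → NodeCoins k :=
  fun u => if u ∈ A then r u else ρ u

theorem measurable_mix (A : Set V) (ρ : V → NodeCoins k) :
    Measurable fun r : V → NodeCoins k => mix A r ρ := by
  classical
  refine measurable_pi_iff.2 fun u => ?_
  unfold mix
  split_ifs
  · exact measurable_pi_apply u
  · exact measurable_const

theorem stateAfter_congr {T : ℕ} {ω ω' : Coins V T k} {t : ℕ}
    (h : ∀ i : Fin T, (i : ℕ) < t → ω i = ω' i) :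
    stateAfter G R θ ω t = stateAfter G R θ ω' t := by
  induction t with
  | zero => rfl
  | succ t ih =>
    simp only [stateAfter]
    rw [ih fun i hi => h i (hi.trans (Nat.lt_succ_self t))]
    split_ifs with ht
    · rw [h ⟨t, ht⟩ (Nat.lt_succ_self t)]
    · rfl

variable [Fintype V]

/-- Once each factor is replaced by its two-hop bound, freezing coins outside `A` has no effect, and
disjointness makes the factors independent given the state. -/
theorem lintegral_prod_potential_step_le {s : State V} (hs : s.Dyadic) (hε : 0 ≤ ε) {t : ℕ}
    {l : ℝ≥0∞}
    (hl : ∀ v, ∫⁻ r : V → NodeCoins k, nextPotential G R θ ε t s v r ≤ l * potential G R ε t s v)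
    {S : Finset V} (hS : (S : Set V).PairwiseDisjoint (twoHop G)) {A : Set V}
    (hA : ∀ v ∈ S, twoHop G v ⊆ A) (ρ : V → NodeCoins k) :
    ∫⁻ r : V → NodeCoins k, ∏ v ∈ S, potential G R ε (t + 1) (step G R θ t s (mix A r ρ)) v ≤
      l ^ S.card * ∏ v ∈ S, potential G R ε t s v := by
  have hm : ∀ v, Measurable fun r : V → NodeCoins k => nextPotential G R θ ε t s v r := fun v =>
    measurable_nextPotential R θ t ε (measurableState_const s) measurable_id v
  calc ∫⁻ r : V → NodeCoins k, ∏ v ∈ S, potential G R ε (t + 1) (step G R θ t s (mix A r ρ)) v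
      ≤ ∫⁻ r : V → NodeCoins k, ∏ v ∈ S, nextPotential G R θ ε t s v r := by
        refine lintegral_mono fun r => Finset.prod_le_prod' fun v hv => ?_
        refine (potential_step_le G R θ hε t hs _ v).trans (le_of_eq ?_)
        exact nextPotential_congr G R θ ε t s v fun u hu => if_pos (hA v hv hu)
    _ = ∏ v ∈ S, ∫⁻ r : V → NodeCoins k, nextPotential G R θ ε t s v r :=
        lintegral_prod_of_dependsOn (μ := fun _ => volume) hm
          (fun v r r' h => nextPotential_congr G R θ ε t s v h) S hS
    _ ≤ ∏ v ∈ S, l * potential G R ε t s v := Finset.prod_le_prod' fun v _ => hl v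
    _ = _ := by rw [Finset.prod_mul_distrib, Finset.prod_const]

theorem lintegral_prod_potential_le (hε : 0 ≤ ε) {l : ℝ≥0∞}
    (hl : ∀ (t : ℕ) (s : State V), s.Dyadic → ∀ v,
      ∫⁻ r : V → NodeCoins k, nextPotential G R θ ε t s v r ≤ l * potential G R ε t s v)
    {S : Finset V} (hS : (S : Set V).PairwiseDisjoint (twoHop G)) {A : Set V}
    (hA : ∀ v ∈ S, twoHop G v ⊆ A) {T : ℕ} (η : Coins V T k) {t : ℕ} (ht : t ≤ T) :
    ∫⁻ ω : Coins V T k, ∏ v ∈ S,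
      potential G R ε t (stateAfter G R θ (fun i => mix A (ω i) (η i)) t) v ≤
      (l ^ t) ^ S.card * ∏ v ∈ S, potential G R ε 0 (State.init V) v := by
  have hF : Measurable fun (ω : Coins V T k) i => mix A (ω i) (η i) :=
    measurable_pi_iff.2 fun i => (measurable_mix A (η i)).comp (measurable_pi_apply i)
  have hmeas : ∀ t, Measurable fun ω : Coins V T k => ∏ v ∈ S,
      potential G R ε t (stateAfter G R θ (fun i => mix A (ω i) (η i)) t) v := fun t =>
    Finset.measurable_prod S fun v _ =>
      measurable_potential R t ε (measurableState_stateAfter R θ hF t) v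
  induction t with
  | zero => simp [stateAfter]
  | succ t ih =>
    have htT : t < T := ht
    calc _ ≤ ∫⁻ ω : Coins V T k, l ^ S.card * ∏ v ∈ S,
          potential G R ε t (stateAfter G R θ (fun i => mix A (ω i) (η i)) t) v := by
          -- Integrating out only the coins of iteration `t` plays the role of conditioning on the
          -- past: the state before it does not depend on them.
          refine lintegral_le_of_lmarginal_le {⟨t, htT⟩} (hmeas (t + 1))
            ((hmeas t).const_mul _) ?_
          rw [lmarginal_singleton, lmarginal_singleton]
          intro ω
          have hst : ∀ y, stateAfter G R θ
              (fun i => mix A (Function.update ω ⟨t, htT⟩ y i) (η i)) t =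
              stateAfter G R θ (fun i => mix A (ω i) (η i)) t := by
            intro y
            refine stateAfter_congr fun i hi => ?_
            have hne : i ≠ ⟨t, htT⟩ := by rintro rfl; exact lt_irrefl _ hi
            rw [Function.update_of_ne hne]
          simp only [hst, lintegral_const, measure_univ, mul_one]
          refine le_trans (le_of_eq ?_) (lintegral_prod_potential_step_le
            (stateAfter_dyadic G R θ (fun i => mix A (ω i) (η i)) t) hε
            (hl t _ (stateAfter_dyadic G R θ _ t)) hS hA (η ⟨t, htT⟩))
          refine lintegral_congr fun y => Finset.prod_congr rfl fun v _ => ?_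
          rw [stateAfter, dif_pos htT, hst, Function.update_self]
      _ = l ^ S.card * ∫⁻ ω : Coins V T k, ∏ v ∈ S,
          potential G R ε t (stateAfter G R θ (fun i => mix A (ω i) (η i)) t) v :=
          lintegral_const_mul _ (hmeas t)
      _ ≤ l ^ S.card * ((l ^ t) ^ S.card * ∏ v ∈ S, potential G R ε 0 (State.init V) v) := by
          gcongr
          exact ih htT.le
      _ = _ := by rw [← mul_assoc, ← mul_pow, pow_succ']

theorem potential_init_le (hε1 : ε ≤ 1) {Δ : ℕ} (hΔ : 1 ≤ Δ) [DecidableRel G.Adj]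
    (hdeg : ∀ v, G.degree v ≤ Δ) (v : V) :
    potential G R ε 0 (State.init V) v ≤ ENNReal.ofReal ((500 * Δ) ^ 4) := by
  classical
  have hΔ' : (1 : ℝ) ≤ Δ := by exact_mod_cast hΔ
  rw [potential, if_pos (show v ∈ (State.init V).active from Set.mem_univ v)]
  refine ENNReal.ofReal_le_ofReal ?_
  have hl : load G (State.init V) (State.init V).p v ≤ Δ := by
    have hcard : (activeNbrs G (State.init V) v).card = G.degree v := by
      rw [← SimpleGraph.card_neighborFinset_eq_degree]
      congr 1
      ext u
      simp [activeNbrs, State.init]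
    have hd : (G.degree v : ℝ) ≤ Δ := by exact_mod_cast hdeg v
    simp only [load, State.init, Finset.sum_const, nsmul_eq_mul]
    change ((activeNbrs G (State.init V) v).card : ℝ) * (1 / 2) ≤ Δ
    rw [hcard]
    linarith
  have hlift : lift R 0 (State.init V).stalling v = 0 := by simp [lift]
  have hp : (State.init V).p v = 1 / 2 := rfl
  have h1 : 1 ≤ pot (load G (State.init V) (State.init V).p v) 0 (1 / 2) :=
    one_le_pot (by norm_num) le_rfl
  rw [hlift, hp]
  calc _ ≤ pot (load G (State.init V) (State.init V).p v) 0 (1 / 2) ^ (1 : ℝ) :=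
        Real.rpow_le_rpow_of_exponent_le h1 hε1
    _ = pot (load G (State.init V) (State.init V).p v) 0 (1 / 2) := Real.rpow_one _
    _ ≤ (500 * Δ) ^ 4 := by
        unfold pot
        norm_num
        have h0 : (0 : ℝ) ≤ max (500 * load G (State.init V) (State.init V).p v) 1 :=
          le_max_of_le_right zero_le_one
        exact pow_le_pow_left₀ h0 (max_le (by linarith) (by linarith)) 4

/-- Markov's inequality for the product of the potentials, each of which is at least 1 if its node
is still active. -/
theorem volume_forall_active_le (hε : 0 ≤ ε) (hε1 : ε ≤ 1) {l : ℝ≥0∞}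
    (hl : ∀ (t : ℕ) (s : State V), s.Dyadic → ∀ v,
      ∫⁻ r : V → NodeCoins k, nextPotential G R θ ε t s v r ≤ l * potential G R ε t s v)
    {Δ : ℕ} (hΔ : 1 ≤ Δ) [DecidableRel G.Adj] (hdeg : ∀ v, G.degree v ≤ Δ)
    {S : Finset V} (hS : (S : Set V).PairwiseDisjoint (twoHop G)) {A : Set V}
    (hA : ∀ v ∈ S, twoHop G v ⊆ A) {T : ℕ} (η : Coins V T k) :
    volume {ω : Coins V T k | ∀ v ∈ S,
      v ∈ (stateAfter G R θ (fun i => mix A (ω i) (η i)) T).active} ≤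
      (l ^ T * ENNReal.ofReal ((500 * Δ) ^ 4)) ^ S.card := by
  have hF : Measurable fun (ω : Coins V T k) i => mix A (ω i) (η i) :=
    measurable_pi_iff.2 fun i => (measurable_mix A (η i)).comp (measurable_pi_apply i)
  have hms := measurableState_stateAfter (G := G) R θ hF T
  have hm : MeasurableSet {ω : Coins V T k | ∀ v ∈ S,
      v ∈ (stateAfter G R θ (fun i => mix A (ω i) (η i)) T).active} :=
    measurableSet_setOfPred.2 (Measurable.forall fun v => measurableSet_setOfPred.1
      (MeasurableSet.imp (.const _) (hms.active v)))
  calc _ = ∫⁻ ω : Coins V T k, {ω : Coins V T k | ∀ v ∈ S,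
        v ∈ (stateAfter G R θ (fun i => mix A (ω i) (η i)) T).active}.indicator 1 ω :=
        (lintegral_indicator_one hm).symm
    _ ≤ ∫⁻ ω : Coins V T k, ∏ v ∈ S,
        potential G R ε T (stateAfter G R θ (fun i => mix A (ω i) (η i)) T) v := by
        refine lintegral_mono fun ω => Set.indicator_apply_le' (fun hω => ?_) fun _ => zero_le
        exact Finset.one_le_prod' fun v hv =>
          one_le_potential G R hε T (stateAfter_dyadic G R θ _ T) (hω v hv)
    _ ≤ (l ^ T) ^ S.card * ∏ v ∈ S, potential G R ε 0 (State.init V) v :=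
        lintegral_prod_potential_le hε hl hS hA η le_rfl
    _ ≤ (l ^ T) ^ S.card * ∏ _v ∈ S, ENNReal.ofReal ((500 * Δ) ^ 4) := by
        gcongr
        exact potential_init_le hε1 hΔ hdeg _
    _ = _ := by rw [Finset.prod_const, ← mul_pow]

end Evolution

/-! ### Choice of the constants, and the tail bound for the remaining nodes. -/

theorem exists_rate : ∃ ε l : ℝ, 0 < ε ∧ ε ≤ 1 ∧ 0 < l ∧ l < 1 ∧ (2⁻¹ : ℝ) ^ ε ≤ l ∧
    (32 : ℝ) ^ ε * (1 - 1 / 18000 * Real.exp (-42)) ≤ l := by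
  set q : ℝ := 1 / 18000 * Real.exp (-42) with hq
  have hq0 : 0 < q := by positivity
  have hcont : Filter.Tendsto (fun ε : ℝ => (32 : ℝ) ^ ε * (1 - q)) (nhdsWithin 0 (Set.Ioi 0))
      (nhds ((32 : ℝ) ^ (0 : ℝ) * (1 - q))) := by
    refine ((Real.continuous_const_rpow (by norm_num)).tendsto 0 |>.mul_const _).mono_left
      nhdsWithin_le_nhds
  rw [Real.rpow_zero, one_mul] at hcont
  -- As ε tends to 0, the growth 32^ε tends to 1, whereas the joining probability `q` does not
  -- depend on ε.
  have h1 := hcont.eventually (gt_mem_nhds (show 1 - q < 1 by linarith))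
  have h2 : ∀ᶠ ε : ℝ in nhdsWithin 0 (Set.Ioi 0), ε ∈ Set.Ioc (0 : ℝ) 1 :=
    Ioc_mem_nhdsGT one_pos
  obtain ⟨ε, hε, hε1⟩ := (h1.and h2).exists
  have h2ε : (2⁻¹ : ℝ) ^ ε < 1 := Real.rpow_lt_one (by norm_num) (by norm_num) hε1.1
  exact ⟨ε, max (2⁻¹ ^ ε) (32 ^ ε * (1 - q)), hε1.1, hε1.2,
    lt_max_of_lt_left (by positivity), max_lt h2ε hε, le_max_left _ _, le_max_right _ _⟩

theorem one_le_logb {Δ : ℕ} (hΔ : 2 ≤ Δ) : 1 ≤ Real.logb 2 Δ := by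
  rw [Real.le_logb_iff_rpow_le one_lt_two (by positivity), Real.rpow_one]
  exact_mod_cast hΔ

/-- With x = α√(log Δ)/10, the threshold is 4^x while the phase length is at most x + 1, so the lift
over a phase costs at most (9/4)(3/2)^x. For the last condition, (3/2)^4 ≤ 2^3 and k ≥ 3R. -/
theorem admissible {α C : ℝ} {Δ : ℕ} (hα : 0 < α) (hα1 : α < 1) (hC : 1 ≤ C) (hΔ : 2 ≤ Δ) :
    Admissible (phaseLength α Δ) (stallThreshold α Δ) (numRepetitions C Δ) := by
  have hL := one_le_logb hΔ
  set L := Real.logb 2 Δ with hLdef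
  have hsq : 1 ≤ √L := Real.one_le_sqrt.2 hL
  have hsq' : √L ≤ L := (Real.sqrt_le_left (by linarith)).2 (by nlinarith)
  set x := α * √L / 10 with hx
  have hx0 : 0 < x := by positivity
  have hx1 : x ≤ L / 10 := by
    have : α * √L ≤ 1 * L := mul_le_mul hα1.le hsq' (by positivity) zero_le_one
    rw [hx]; linarith
  have hR : (phaseLength α Δ : ℝ) ≤ x + 1 := (Nat.ceil_lt_add_one hx0.le).le
  have hθ : stallThreshold α Δ = 4 ^ x := by
    rw [stallThreshold, ← hLdef, show (4 : ℝ) = 2 ^ (2 : ℝ) by norm_num, ← Real.rpow_mul (by norm_num)]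
    congr 1
    rw [hx]; ring
  refine ⟨Nat.ceil_pos.2 hx0, ?_, ?_, ?_⟩
  · rw [hθ]; exact Real.one_le_rpow (by norm_num) hx0.le
  · rw [hθ]
    calc (3 / 2 : ℝ) ^ (phaseLength α Δ + 1) = (3 / 2 : ℝ) ^ ((phaseLength α Δ : ℝ) + 1) := by
          rw [← Real.rpow_natCast]; push_cast; rfl
      _ ≤ (3 / 2 : ℝ) ^ (2 + x) := Real.rpow_le_rpow_of_exponent_le (by norm_num) (by linarith)
      _ = (3 / 2) ^ (2 : ℝ) * (3 / 2) ^ x := Real.rpow_add (by norm_num) _ _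
      _ ≤ 5 / 2 * 4 ^ x := by
          refine mul_le_mul (by norm_num) (Real.rpow_le_rpow (by norm_num) (by norm_num) hx0.le)
            (by positivity) (by norm_num)
  · have hk : 3 * phaseLength α Δ ≤ numRepetitions C Δ := by
      have h1 : 12 * C * L ≤ numRepetitions C Δ := Nat.le_ceil _
      have h2 : 12 * 1 * L ≤ 12 * C * L := by gcongr
      have : ((3 * phaseLength α Δ : ℕ) : ℝ) ≤ numRepetitions C Δ := by
        push_cast; linarith
      exact_mod_cast this
    calc ((3 / 2 : ℝ) ^ phaseLength α Δ) ^ 4 = ((3 / 2) ^ 4) ^ phaseLength α Δ := by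
          rw [← pow_mul, ← pow_mul, mul_comm]
      _ ≤ (2 ^ 3) ^ phaseLength α Δ := pow_le_pow_left₀ (by norm_num) (by norm_num) _
      _ = 2 ^ (3 * phaseLength α Δ) := by rw [pow_mul]
      _ ≤ 2 ^ numRepetitions C Δ := pow_le_pow_right₀ one_le_two hk

theorem exists_small_error {δ : ℝ} (hδ : 0 < δ) : ∃ C₁ : ℝ, 1 ≤ C₁ ∧ ∀ C : ℝ, C₁ ≤ C → ∀ Δ : ℕ,
    2 ≤ Δ → 672 * (2⁻¹ : ℝ) ^ numRepetitions C Δ ≤ δ := by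
  obtain ⟨n, hn⟩ := exists_pow_lt_of_lt_one (show 0 < δ / 672 by positivity)
    (by norm_num : (2⁻¹ : ℝ) < 1)
  refine ⟨n + 1, by simp, fun C hC Δ hΔ => ?_⟩
  have hL := one_le_logb hΔ
  have hk : n ≤ numRepetitions C Δ := by
    have h1 : 12 * C * Real.logb 2 Δ ≤ numRepetitions C Δ := Nat.le_ceil _
    have hn0 : (0 : ℝ) ≤ n := n.cast_nonneg
    have h2 : 12 * C * 1 ≤ 12 * C * Real.logb 2 Δ :=
      mul_le_mul_of_nonneg_left hL (by linarith)
    have : (n : ℝ) ≤ numRepetitions C Δ := by linarith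
    exact_mod_cast this
  have := pow_le_pow_of_le_one (by norm_num : (0 : ℝ) ≤ 2⁻¹) (by norm_num) hk
  linarith

theorem decay_le {l C c : ℝ} (hl : 0 < l) (hl1 : l < 1) (hc : (C + 40) / -Real.logb 2 l ≤ c)
    {Δ : ℕ} (hΔ : 2 ≤ Δ) :
    l ^ numIterations c Δ * (500 * Δ) ^ 4 ≤ (Δ : ℝ) ^ (-C) := by
  have hL := one_le_logb hΔ
  have hΔ2 : (2 : ℝ) ≤ Δ := by exact_mod_cast hΔ
  have hΔ0 : (0 : ℝ) < Δ := by linarith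
  have hlog : Real.logb 2 l < 0 := Real.logb_neg one_lt_two hl hl1
  have h1 : (C + 40) ≤ c * -Real.logb 2 l := (div_le_iff₀ (by linarith)).1 hc
  have h2 : l ^ numIterations c Δ ≤ (Δ : ℝ) ^ (-(C + 40)) := by
    calc l ^ numIterations c Δ = l ^ (numIterations c Δ : ℝ) := (Real.rpow_natCast _ _).symm
      _ ≤ l ^ (c * Real.logb 2 Δ) :=
          Real.rpow_le_rpow_of_exponent_ge hl hl1.le (Nat.le_ceil _)
      _ = (Δ : ℝ) ^ (c * Real.logb 2 l) := by
          nth_rewrite 1 [← Real.rpow_logb two_pos (by norm_num) hl]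
          nth_rewrite 2 [← Real.rpow_logb two_pos (by norm_num) hΔ0]
          rw [← Real.rpow_mul (by norm_num), ← Real.rpow_mul (by norm_num)]
          congr 1
          ring
      _ ≤ _ := Real.rpow_le_rpow_of_exponent_le (by linarith) (by linarith)
  -- The surplus 40 in the exponent pays for the initial potential: 500 ≤ 2^9 ≤ Δ^9.
  have h3 : ((500 : ℝ) * Δ) ^ 4 ≤ (Δ : ℝ) ^ (40 : ℝ) := by
    have h4 : (500 : ℝ) ≤ (Δ : ℝ) ^ 9 := by
      calc (500 : ℝ) ≤ 2 ^ 9 := by norm_num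
        _ ≤ _ := by gcongr
    calc ((500 : ℝ) * Δ) ^ 4 ≤ ((Δ : ℝ) ^ 9 * Δ) ^ 4 := by gcongr
      _ = (Δ : ℝ) ^ (40 : ℝ) := by
          rw [show (40 : ℝ) = (40 : ℕ) by norm_num, Real.rpow_natCast]; ring
  calc _ ≤ (Δ : ℝ) ^ (-(C + 40)) * (Δ : ℝ) ^ (40 : ℝ) := by gcongr
    _ = (Δ : ℝ) ^ (-C) := by
      rw [← Real.rpow_add hΔ0]
      congr 1
      ring

/-- Nodes with disjoint two-hop neighborhoods all remain with the product of the failure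
probabilities only, whatever the randomness outside their two-hop neighborhoods is. -/
theorem exists_volume_remaining_le : ∃ C₁ : ℝ, 1 ≤ C₁ ∧ ∀ C : ℝ, C₁ ≤ C → ∃ c₀ : ℝ, ∀ c : ℝ,
    c₀ ≤ c → ∀ α : ℝ, 0 < α → α < 1 → ∀ (V : Type u) [Fintype V] (G : SimpleGraph V)
    [DecidableRel G.Adj] (Δ : ℕ), 2 ≤ Δ → (∀ v, G.degree v ≤ Δ) →
    ∀ (S : Finset V) (A : Set V) (η : Coins V (numIterations c Δ) (numRepetitions C Δ)),
      (S : Set V).PairwiseDisjoint (twoHop G) → (∀ v ∈ S, twoHop G v ⊆ A) →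
      volume {ω : Coins V (numIterations c Δ) (numRepetitions C Δ) |
        ∀ v ∈ S, v ∈ remaining G α Δ fun i => mix A (ω i) (η i)} ≤
        ENNReal.ofReal ((Δ : ℝ) ^ (-C)) ^ S.card := by
  obtain ⟨ε, l, hε, hε1, hl0, hl1, h2, h32⟩ := exists_rate
  obtain ⟨C₁, hC₁, hsmall⟩ := exists_small_error (show 0 < (1 - l) / 2 by linarith)
  -- The rate (1 + l)/2 leaves room (1 - l)/2 for the sampling error.
  refine ⟨C₁, hC₁, fun C hC => ⟨(C + 40) / -Real.logb 2 ((1 + l) / 2), ?_⟩⟩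
  intro c hc α hα hα1 V _ G _ Δ hΔ hdeg S A η hS hA
  have ha := admissible hα hα1 (hC₁.trans hC) hΔ
  have hlam : ENNReal.ofReal l + 672 * 2⁻¹ ^ numRepetitions C Δ ≤ ENNReal.ofReal ((1 + l) / 2) := by
    have h672 : (672 : ℝ≥0∞) * 2⁻¹ ^ numRepetitions C Δ =
        ENNReal.ofReal (672 * 2⁻¹ ^ numRepetitions C Δ) := by
      rw [ENNReal.ofReal_mul (by norm_num), ENNReal.ofReal_pow (by norm_num),
        ENNReal.ofReal_inv_of_pos two_pos]
      norm_num
    rw [h672, ← ENNReal.ofReal_add hl0.le (by positivity)]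
    exact ENNReal.ofReal_le_ofReal (by linarith [hsmall C hC Δ hΔ])
  refine (volume_forall_active_le hε.le hε1 (l := ENNReal.ofReal ((1 + l) / 2))
    (fun t s hs v => (lintegral_nextPotential_le ha hs hε hε1 h2 h32 v).trans
      (mul_le_mul_left hlam _)) (by omega) hdeg hS hA η).trans ?_
  gcongr
  rw [← ENNReal.ofReal_pow (by linarith), ← ENNReal.ofReal_mul (by positivity)]
  exact ENNReal.ofReal_le_ofReal (decay_le (by linarith) (by linarith) hc hΔ)

/-! ### Balls, separated sets and chains through connected sets. -/

section Separation

variable {V : Type*} (G : SimpleGraph V)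

/-- The elements of `S` are at pairwise distance at least five. -/
def Separated (S : Set V) : Prop := S.Pairwise fun x y => 4 < G.edist x y

variable {G}

theorem Separated.pairwiseDisjoint {S : Set V} (hS : Separated G S) :
    S.PairwiseDisjoint (twoHop G) := by
  intro x hx y hy hne
  refine Set.disjoint_left.2 fun z hzx hzy => (hS hx hy hne).not_ge ?_
  calc G.edist x y ≤ G.edist x z + G.edist z y := SimpleGraph.edist_triangle ..
    _ ≤ 2 + 2 := add_le_add hzx (by rw [SimpleGraph.edist_comm]; exact hzy)
    _ = 4 := by norm_num

theorem Separated.mono {S S' : Set V} (hS : Separated G S) (h : S' ⊆ S) : Separated G S' :=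
  Set.Pairwise.mono h hS

theorem Separated.insert {S : Set V} (hS : Separated G S) {b : V}
    (hb : ∀ y ∈ S, 4 < G.edist y b) : Separated G (insert b S) := by
  refine Set.pairwise_insert.2 ⟨hS, fun y hy _ => ⟨?_, hb y hy⟩⟩
  rw [SimpleGraph.edist_comm]; exact hb y hy

variable [Fintype V]

open Classical in
variable (G) in
/-- The nodes at distance at most `r` from `v`. -/
noncomputable def closedBall (r : ℕ) (v : V) : Finset V := {u | G.edist v u ≤ r}

theorem mem_closedBall {r : ℕ} {v u : V} : u ∈ closedBall G r v ↔ G.edist v u ≤ r := by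
  simp [closedBall]

/-- Strictness carries the induction: 1 + Δ(2Δ^r - 1) < 2Δ^(r+1) because Δ ≥ 2. -/
theorem card_closedBall_lt [DecidableRel G.Adj] {Δ : ℕ} (hΔ : 2 ≤ Δ)
    (hdeg : ∀ v, G.degree v ≤ Δ) (r : ℕ) (v : V) : (closedBall G r v).card < 2 * Δ ^ r := by
  classical
  induction r generalizing v with
  | zero =>
    have : closedBall G 0 v = {v} := by
      ext u
      rw [mem_closedBall, Nat.cast_zero, nonpos_iff_eq_zero, SimpleGraph.edist_eq_zero_iff,
        Finset.mem_singleton, eq_comm]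
    simp [this]
  | succ r ih =>
    have hsub : closedBall G (r + 1) v ⊆
        insert v ((G.neighborFinset v).biUnion fun u => closedBall G r u) := by
      intro u hu
      rw [mem_closedBall] at hu
      obtain ⟨w, hw⟩ := G.exists_walk_of_edist_ne_top (ne_top_of_le_ne_top (by simp) hu)
      rw [← hw] at hu
      cases w with
      | nil => simp
      | cons h p =>
        refine Finset.mem_insert_of_mem (Finset.mem_biUnion.2 ⟨_, by simpa using h, ?_⟩)
        rw [mem_closedBall]
        refine (SimpleGraph.edist_le p).trans ?_
        rw [SimpleGraph.Walk.length_cons] at hu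
        have : p.length + 1 ≤ r + 1 := by exact_mod_cast hu
        exact_mod_cast (by omega : p.length ≤ r)
    have h1 : ((G.neighborFinset v).biUnion fun u => closedBall G r u).card ≤
        (G.neighborFinset v).card * (2 * Δ ^ r - 1) :=
      Finset.card_biUnion_le_card_mul _ _ _ fun u _ => by have := ih u; omega
    have h2 : (G.neighborFinset v).card * (2 * Δ ^ r - 1) ≤ Δ * (2 * Δ ^ r - 1) := by
      gcongr
      rw [SimpleGraph.card_neighborFinset_eq_degree]
      exact hdeg v
    have h3 := (Finset.card_le_card hsub).trans (Finset.card_insert_le _ _)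
    have h4 : Δ * (2 * Δ ^ r - 1) = 2 * Δ ^ (r + 1) - Δ := by
      rw [Nat.mul_sub, mul_one, pow_succ]; ring_nf
    have h5 : Δ ≤ Δ ^ (r + 1) := Nat.le_self_pow (by omega) Δ
    omega

theorem card_le_of_subset_biUnion [DecidableEq V] [DecidableRel G.Adj] {Δ : ℕ} (hΔ : 2 ≤ Δ)
    (hdeg : ∀ v, G.degree v ≤ Δ) {r : ℕ} {X S : Finset V} (h : X ⊆ S.biUnion (closedBall G r)) :
    X.card ≤ S.card * (2 * Δ ^ r) :=
  (Finset.card_le_card h).trans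
    (Finset.card_biUnion_le_card_mul _ _ _ fun u _ => (card_closedBall_lt hΔ hdeg r u).le)

/-- For a maximal separated subset of `X`, the balls of radius 4 around its elements cover `X`. -/
theorem exists_separated_subset [DecidableRel G.Adj] {Δ : ℕ} (hΔ : 2 ≤ Δ)
    (hdeg : ∀ v, G.degree v ≤ Δ) (X : Finset V) :
    ∃ S ⊆ X, Separated G (S : Set V) ∧ X.card ≤ S.card * (2 * Δ ^ 4) := by
  classical
  obtain ⟨S, hS, hmax⟩ := (X.powerset.filter fun S : Finset V => Separated G (S : Set V)).exists_maximal
    ⟨∅, Finset.mem_filter.2 ⟨Finset.empty_mem_powerset X, by simp [Separated]⟩⟩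
  simp only [Finset.mem_filter, Finset.mem_powerset] at hS hmax
  refine ⟨S, hS.1, hS.2, card_le_of_subset_biUnion hΔ hdeg fun b hb => ?_⟩
  by_contra hcov
  have hfar : ∀ y ∈ S, 4 < G.edist y b := by
    intro y hy
    by_contra h
    exact hcov (Finset.mem_biUnion.2 ⟨y, hy, mem_closedBall.2 (not_lt.1 h)⟩)
  have hins := hmax (y := insert b S) ⟨Finset.insert_subset hb hS.1, by
    rw [Finset.coe_insert]; exact hS.2.insert hfar⟩ (Finset.subset_insert b S)
  have := hfar b (hins (Finset.mem_insert_self b S))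
  simp at this

open Classical in
/-- A large connected set contains a separated set of prescribed size whose elements are visited by
a short sequence of steps of length at most five. -/
theorem exists_separated_chain [DecidableRel G.Adj] {Δ : ℕ} (hΔ : 2 ≤ Δ)
    (hdeg : ∀ v, G.degree v ≤ Δ) {X : Finset V}
    (hconn : ∀ P : Set V, (∃ a ∈ X, a ∈ P) → (∃ b ∈ X, b ∉ P) →
      ∃ a ∈ X, ∃ b ∈ X, G.Adj a b ∧ a ∈ P ∧ b ∉ P) (m : ℕ) (hm : m * (2 * Δ ^ 4) < X.card) :
    ∃ w : List V, w.length = 2 * m + 1 ∧ w.IsChain (fun a b => b ∈ closedBall G 5 a) ∧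
      w.toFinset ⊆ X ∧ w.toFinset.card = m + 1 ∧ Separated G (w.toFinset : Set V) := by
  induction m with
  | zero =>
    obtain ⟨x, hx⟩ := Finset.card_pos.1 (by omega : 0 < X.card)
    exact ⟨[x], by simp, by simp, by simpa using hx, by simp, by simp [Separated]⟩
  | succ m ih =>
    obtain ⟨w, hlen, hchain, hsub, hcard, hsep⟩ := ih
      ((Nat.mul_le_mul_right _ (Nat.le_succ m)).trans_lt hm)
    have hncov : ¬ X ⊆ w.toFinset.biUnion (closedBall G 4) := fun h => by
      have := card_le_of_subset_biUnion hΔ hdeg h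
      rw [hcard] at this
      omega
    obtain ⟨z, hzX, hz⟩ := Finset.not_subset.1 hncov
    obtain ⟨x, hx⟩ := Finset.card_pos.1 (by omega : 0 < w.toFinset.card)
    -- An edge leaving the covered region ends in a node `b` that is farther than 4 from every
    -- chosen node but within 5 of one of them.
    obtain ⟨a, -, b, hbX, hab, ha, hb⟩ := hconn (w.toFinset.biUnion (closedBall G 4) : Finset V)
      ⟨x, hsub hx, Finset.mem_coe.2 (Finset.mem_biUnion.2 ⟨x, hx, by simp [mem_closedBall]⟩)⟩
      ⟨z, hzX, hz⟩
    obtain ⟨y, hy, hya⟩ := Finset.mem_biUnion.1 (Finset.mem_coe.1 ha)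
    rw [mem_closedBall] at hya
    have hyb : G.edist y b ≤ (5 : ℕ) := by
      calc G.edist y b ≤ G.edist y a + G.edist a b := SimpleGraph.edist_triangle ..
        _ ≤ (4 : ℕ) + 1 := add_le_add hya (SimpleGraph.edist_eq_one_iff_adj.2 hab).le
        _ = (5 : ℕ) := by norm_num
    have hfar : ∀ y ∈ w.toFinset, 4 < G.edist y b := by
      intro y hy
      by_contra h
      exact hb (Finset.mem_coe.2 (Finset.mem_biUnion.2 ⟨y, hy, mem_closedBall.2 (not_lt.1 h)⟩))
    have hbw : b ∉ w.toFinset := fun h => by simpa using hfar b h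
    -- Replacing `y` by the detour `y, b, y` costs two list entries and adds one new node;
    -- repetitions in the list are harmless.
    obtain ⟨l₁, l₂, rfl⟩ := List.append_of_mem (List.mem_toFinset.1 hy)
    have hfin : (l₁ ++ y :: b :: y :: l₂).toFinset = insert b (l₁ ++ y :: l₂).toFinset := by
      ext u
      simp only [List.mem_toFinset, List.mem_append, List.mem_cons, Finset.mem_insert]
      grind
    refine ⟨l₁ ++ y :: b :: y :: l₂, ?_, ?_, ?_, ?_, ?_⟩
    · simp only [List.length_append, List.length_cons] at hlen ⊢
      omega
    · rw [List.isChain_split] at hchain ⊢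
      refine ⟨hchain.1, ?_⟩
      rw [List.isChain_cons_cons, List.isChain_cons_cons]
      refine ⟨mem_closedBall.2 hyb, mem_closedBall.2 ?_, hchain.2⟩
      rwa [SimpleGraph.edist_comm]
    · rw [hfin]; exact Finset.insert_subset hbX hsub
    · rw [hfin, Finset.card_insert_of_notMem hbw, hcard]
    · rw [hfin, Finset.coe_insert]; exact hsep.insert hfar

end Separation

/-! ### Counting chains. -/

section ChainLists

variable {V : Type*} [DecidableEq V] (nb : V → Finset V)

/-- The lists with `l` steps from `u`, each to an element of the given neighborhood. -/
def chainListsFrom : ℕ → V → Finset (List V)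
  | 0, u => {[u]}
  | l + 1, u => (nb u).biUnion fun w => (chainListsFrom l w).image (List.cons u)

theorem card_chainListsFrom_le {D : ℕ} (hD : ∀ u, (nb u).card ≤ D) (l : ℕ) (u : V) :
    (chainListsFrom nb l u).card ≤ D ^ l := by
  induction l generalizing u with
  | zero => simp [chainListsFrom]
  | succ l ih =>
    rw [chainListsFrom, pow_succ']
    refine (Finset.card_biUnion_le_card_mul _ _ (D ^ l) fun w _ =>
      Finset.card_image_le.trans (ih w)).trans ?_
    gcongr
    exact hD u

theorem mem_chainListsFrom {l : ℕ} {u : V} {w : List V} (hlen : (u :: w).length = l + 1)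
    (hw : (u :: w).IsChain fun a b => b ∈ nb a) : u :: w ∈ chainListsFrom nb l u := by
  induction l generalizing u w with
  | zero =>
    obtain rfl : w = [] := by simpa using hlen
    simp [chainListsFrom]
  | succ l ih =>
    cases w with
    | nil => simp at hlen
    | cons x w =>
      rw [List.isChain_cons_cons] at hw
      rw [chainListsFrom]
      exact Finset.mem_biUnion.2 ⟨x, hw.1, Finset.mem_image_of_mem _ (ih (by simpa using hlen) hw.2)⟩

theorem exists_finset_chainLists [Fintype V] {D : ℕ} (hD : ∀ u, (nb u).card ≤ D) (l : ℕ) :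
    ∃ W : Finset (List V), W.card ≤ Fintype.card V * D ^ l ∧
      ∀ w : List V, w.length = l + 1 → w.IsChain (fun a b => b ∈ nb a) → w ∈ W := by
  refine ⟨Finset.univ.biUnion (chainListsFrom nb l), Finset.card_biUnion_le_card_mul _ _ _
    fun u _ => card_chainListsFrom_le nb hD l u, fun w hlen hw => ?_⟩
  cases w with
  | nil => simp at hlen
  | cons u w => exact Finset.mem_biUnion.2 ⟨u, Finset.mem_univ u, mem_chainListsFrom nb hlen hw⟩

end ChainLists

theorem connectedComponent_exists_boundary {V : Type*} {G : SimpleGraph V} {B : Set V}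
    (X : (G.induce B).ConnectedComponent) (P : Set V) (ha : ∃ a ∈ X.supp, a.1 ∈ P)
    (hb : ∃ b ∈ X.supp, b.1 ∉ P) :
    ∃ a ∈ X.supp, ∃ b ∈ X.supp, G.Adj a.1 b.1 ∧ a.1 ∈ P ∧ b.1 ∉ P := by
  obtain ⟨a, haX, haP⟩ := ha
  obtain ⟨b, hbX, hbP⟩ := hb
  have hr : (G.induce B).Reachable a b :=
    SimpleGraph.ConnectedComponent.exact (haX.trans hbX.symm)
  obtain ⟨p⟩ := hr
  obtain ⟨d, -, hd1, hd2⟩ := p.exists_boundary_dart {x | x ∈ X.supp ∧ x.1 ∈ P} ⟨haX, haP⟩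
    fun h => hbP h.2
  have hX2 : d.snd ∈ X.supp :=
    (SimpleGraph.ConnectedComponent.sound d.adj.reachable.symm).trans hd1.1
  exact ⟨d.fst, hd1.1, d.snd, hX2, d.adj, hd1.2, fun h => hd2 ⟨hX2, h⟩⟩

/-! ### Union bounds over nodes, chains and separated subsets. -/

section Shattering

variable {V : Type*} [Fintype V] {G : SimpleGraph V}
  {Ω : Type*} [MeasurableSpace Ω] {P : Measure Ω} {B : Ω → Set V} {δ : ℝ≥0∞}

theorem measure_nonempty_le
    (hP : ∀ S : Finset V, Separated G (S : Set V) → P {ω | ∀ v ∈ S, v ∈ B ω} ≤ δ ^ S.card) :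
    P {ω | (B ω).Nonempty} ≤ Fintype.card V * δ := by
  calc P {ω | (B ω).Nonempty} ≤ P (⋃ v ∈ (Finset.univ : Finset V), {ω | v ∈ B ω}) := by
        refine measure_mono fun ω hω => ?_
        obtain ⟨v, hv⟩ := hω
        exact Set.mem_biUnion (Finset.mem_univ v) hv
    _ ≤ ∑ v : V, P {ω | v ∈ B ω} := measure_biUnion_finset_le _ _
    _ ≤ ∑ _v : V, δ := by
        refine Finset.sum_le_sum fun v _ => ?_
        have := hP {v} (by simp [Separated])
        simpa using this
    _ = Fintype.card V * δ := by simp [Finset.card_univ]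

variable [DecidableRel G.Adj] {Δ : ℕ}

/-- The union runs over chains of 2m steps of length at most 5, not over all sets of m + 1 nodes, so
each further separated node costs only a factor (2Δ^5)^2. -/
theorem measure_exists_large_component_le (hΔ : 2 ≤ Δ) (hdeg : ∀ v, G.degree v ≤ Δ)
    (hP : ∀ S : Finset V, Separated G (S : Set V) → P {ω | ∀ v ∈ S, v ∈ B ω} ≤ δ ^ S.card)
    (m : ℕ) :
    P {ω | ∃ X : (G.induce (B ω)).ConnectedComponent, m * (2 * Δ ^ 4) < X.supp.ncard} ≤
      ((Fintype.card V * (2 * Δ ^ 5) ^ (2 * m) : ℕ) : ℝ≥0∞) * δ ^ (m + 1) := by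
  classical
  obtain ⟨W, hW, hmem⟩ := exists_finset_chainLists (closedBall G 5)
    (fun u => (card_closedBall_lt hΔ hdeg 5 u).le) (2 * m)
  set W' := W.filter fun w => w.toFinset.card = m + 1 ∧ Separated G (w.toFinset : Set V) with hW'
  have hle : W'.card ≤ Fintype.card V * (2 * Δ ^ 5) ^ (2 * m) :=
    (Finset.card_filter_le _ _).trans hW
  calc _ ≤ P (⋃ w ∈ W', {ω | ∀ v ∈ w.toFinset, v ∈ B ω}) := by
        refine measure_mono fun ω hω => ?_
        obtain ⟨X, hX⟩ := hω
        have hcoe : ((Subtype.val '' X.supp).toFinset : Set V) = Subtype.val '' X.supp := by simp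
        have hcard : (Subtype.val '' X.supp).toFinset.card = X.supp.ncard := by
          rw [← Set.ncard_coe_finset, hcoe, Set.ncard_image_of_injective _ Subtype.val_injective]
        obtain ⟨w, hlen, hchain, hsub, hwcard, hsep⟩ := exists_separated_chain hΔ hdeg
          (X := (Subtype.val '' X.supp).toFinset) (fun Q ha hb => by
            obtain ⟨a, haX, b, hbX, h⟩ := connectedComponent_exists_boundary X Q
              (by simpa using ha) (by simpa using hb)
            exact ⟨a, by simpa using haX, b, by simpa using hbX, h⟩) m (by rwa [hcard])
        refine Set.mem_biUnion (x := w)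
          (Finset.mem_filter.2 ⟨hmem w hlen hchain, hwcard, hsep⟩) fun v hv => ?_
        have := hsub hv
        rw [Set.mem_toFinset] at this
        obtain ⟨a, -, rfl⟩ := this
        exact a.2
    _ ≤ ∑ w ∈ W', P {ω | ∀ v ∈ w.toFinset, v ∈ B ω} := measure_biUnion_finset_le _ _
    _ ≤ ∑ _w ∈ W', δ ^ (m + 1) := by
        refine Finset.sum_le_sum fun w hw => ?_
        obtain ⟨-, hcard, hsep⟩ := Finset.mem_filter.1 hw
        exact (hP _ hsep).trans (by rw [hcard])
    _ ≤ _ := by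
        rw [Finset.sum_const, nsmul_eq_mul]
        gcongr

theorem measure_large_le (hΔ : 2 ≤ Δ) (hdeg : ∀ v, G.degree v ≤ Δ)
    (hP : ∀ S : Finset V, Separated G (S : Set V) → P {ω | ∀ v ∈ S, v ∈ B ω} ≤ δ ^ S.card)
    (x : ℝ) :
    P {ω | x * (2 * Δ ^ 4) < (B ω).ncard} ≤ ((Fintype.card V).choose ⌈x⌉₊ : ℝ≥0∞) * δ ^ ⌈x⌉₊ := by
  classical
  set 𝒮 := ((Finset.univ : Finset V).powersetCard ⌈x⌉₊).filter
    fun S : Finset V => Separated G (S : Set V) with h𝒮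
  calc _ ≤ P (⋃ S ∈ 𝒮, {ω | ∀ v ∈ S, v ∈ B ω}) := by
        refine measure_mono fun ω hω => ?_
        obtain ⟨S, hSB, hsep, hcard⟩ := exists_separated_subset hΔ hdeg (B ω).toFinset
        rw [← Set.ncard_eq_toFinset_card'] at hcard
        have hx : ⌈x⌉₊ ≤ S.card := by
          refine Nat.ceil_le.2 ?_
          have h1 : ((B ω).ncard : ℝ) ≤ S.card * (2 * Δ ^ 4) := by exact_mod_cast hcard
          have h2 : x * (2 * Δ ^ 4) < (B ω).ncard := hω
          have h3 : (0 : ℝ) < 2 * Δ ^ 4 := by positivity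
          exact (lt_of_mul_lt_mul_right (h2.trans_le h1) h3.le).le
        obtain ⟨S', hS', hcard'⟩ := Finset.exists_subset_card_eq hx
        refine Set.mem_biUnion (x := S') (Finset.mem_filter.2
          ⟨Finset.mem_powersetCard.2 ⟨Finset.subset_univ _, hcard'⟩,
            hsep.mono (Finset.coe_subset.2 hS')⟩) fun v hv => ?_
        exact Set.mem_toFinset.1 (hSB (hS' hv))
    _ ≤ ∑ S ∈ 𝒮, P {ω | ∀ v ∈ S, v ∈ B ω} := measure_biUnion_finset_le _ _
    _ ≤ ∑ _S ∈ 𝒮, δ ^ ⌈x⌉₊ := by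
        refine Finset.sum_le_sum fun S hS => ?_
        obtain ⟨hS1, hsep⟩ := Finset.mem_filter.1 hS
        exact (hP _ hsep).trans (by rw [(Finset.mem_powersetCard.1 hS1).2])
    _ ≤ _ := by
        rw [Finset.sum_const, nsmul_eq_mul]
        gcongr
        refine (Finset.card_filter_le _ _).trans ?_
        rw [Finset.card_powersetCard, Finset.card_univ]

end Shattering

/-! ### Numerical estimates for the union bounds. -/

section Estimates

theorem choose_mul_pow_le_exp (n m : ℕ) {y : ℝ} (hy : 0 ≤ y) :
    (n.choose m : ℝ) * y ^ m ≤ Real.exp (n * y) := by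
  rcases le_or_gt m n with h | h
  · calc (n.choose m : ℝ) * y ^ m ≤ (y + 1) ^ n := by
          rw [add_pow]
          refine le_trans (le_of_eq ?_) (Finset.single_le_sum
            (f := fun i => y ^ i * 1 ^ (n - i) * (n.choose i : ℝ)) (fun i _ => by positivity)
            (Finset.mem_range.2 (Nat.lt_succ_of_le h)))
          simp [mul_comm]
      _ ≤ Real.exp y ^ n := pow_le_pow_left₀ (by positivity) (Real.add_one_le_exp y) n
      _ = Real.exp (n * y) := (Real.exp_nat_mul y n).symm
  · rw [Nat.choose_eq_zero_of_lt h]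
    simp [Real.exp_nonneg]

/-- With m the number of chosen nodes, the binomial coefficient is at most (6Δ^14)^m ≤ Δ^(17m), and
n ≤ m^2 ≤ 4^m ≤ Δ^(2m). Thus 39 = 17 + 2·11 suffices. -/
theorem choose_mul_pow_le {n Δ E : ℕ} (hΔ : 2 ≤ Δ) (hn : Δ ^ 100 ≤ n) (hE : 39 ≤ E) :
    (n.choose ⌈(n : ℝ) / (2 * Δ ^ 14)⌉₊ : ℝ) * ((Δ ^ E : ℝ)⁻¹) ^ ⌈(n : ℝ) / (2 * Δ ^ 14)⌉₊ ≤
      ((n : ℝ) ^ 11)⁻¹ := by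
  set m := ⌈(n : ℝ) / (2 * Δ ^ 14)⌉₊ with hm
  have hΔ2 : (2 : ℝ) ≤ Δ := by exact_mod_cast hΔ
  have hΔ0 : (0 : ℝ) < Δ := by linarith
  have hΔ1 : (1 : ℝ) ≤ Δ := by linarith
  have hnR : (Δ : ℝ) ^ 100 ≤ n := by exact_mod_cast hn
  have hn0 : (0 : ℝ) < n := lt_of_lt_of_le (by positivity) hnR
  have hmn : (n : ℝ) / (2 * Δ ^ 14) ≤ m := Nat.le_ceil _
  have hchoose : (n.choose m : ℝ) ≤ (Δ ^ 17) ^ m := by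
    have h1 := choose_mul_pow_le_exp n m (y := 1 / (2 * (Δ : ℝ) ^ 14)) (by positivity)
    have h2 : Real.exp (n * (1 / (2 * (Δ : ℝ) ^ 14))) ≤ 3 ^ m := by
      calc _ ≤ Real.exp (m * 1) := Real.exp_le_exp.2 (by rw [mul_one_div, mul_one]; exact hmn)
        _ = Real.exp 1 ^ m := by rw [Real.exp_nat_mul]
        _ ≤ 3 ^ m := pow_le_pow_left₀ (Real.exp_nonneg 1) (by linarith [Real.exp_one_lt_d9]) m
    have h3 : (n.choose m : ℝ) = n.choose m * (1 / (2 * (Δ : ℝ) ^ 14)) ^ m *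
        (2 * (Δ : ℝ) ^ 14) ^ m := by
      rw [mul_assoc, ← mul_pow]
      field_simp
      simp
    rw [h3]
    calc _ ≤ 3 ^ m * (2 * (Δ : ℝ) ^ 14) ^ m := by
          gcongr
          exact h1.trans h2
      _ = (6 * (Δ : ℝ) ^ 14) ^ m := by rw [← mul_pow]; ring
      _ ≤ (Δ ^ 17) ^ m := by
          gcongr
          calc (6 : ℝ) * (Δ : ℝ) ^ 14 ≤ 2 ^ 3 * (Δ : ℝ) ^ 14 := by gcongr; norm_num
            _ ≤ Δ ^ 3 * (Δ : ℝ) ^ 14 := by gcongr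
            _ = Δ ^ 17 := by ring
  have hsq : (n : ℝ) ≤ (m : ℝ) ^ 2 := by
    have h4 : 4 * (Δ : ℝ) ^ 28 ≤ n := by
      calc 4 * (Δ : ℝ) ^ 28 ≤ Δ ^ 2 * Δ ^ 28 := by gcongr; nlinarith
        _ = (Δ : ℝ) ^ 30 := by ring
        _ ≤ Δ ^ 100 := pow_le_pow_right₀ hΔ1 (by norm_num)
        _ ≤ n := hnR
    calc (n : ℝ) ≤ (n / (2 * Δ ^ 14)) ^ 2 := by
          rw [div_pow, le_div_iff₀ (by positivity)]
          calc (n : ℝ) * (2 * (Δ : ℝ) ^ 14) ^ 2 = n * (4 * (Δ : ℝ) ^ 28) := by ring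
            _ ≤ (n : ℝ) * n := by gcongr
            _ = (n : ℝ) ^ 2 := by ring
      _ ≤ (m : ℝ) ^ 2 := by gcongr
  have hpow : (n : ℝ) ≤ ((Δ : ℝ) ^ 2) ^ m := by
    have h5 : (m : ℝ) ≤ 2 ^ m := by exact_mod_cast Nat.lt_two_pow_self.le
    calc (n : ℝ) ≤ (2 ^ m) ^ 2 := hsq.trans (by gcongr)
      _ ≤ ((Δ : ℝ) ^ m) ^ 2 := by gcongr
      _ = ((Δ : ℝ) ^ 2) ^ m := by rw [← pow_mul, ← pow_mul, mul_comm]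
  calc (n.choose m : ℝ) * ((Δ ^ E : ℝ)⁻¹) ^ m ≤ (Δ ^ 17) ^ m * ((Δ ^ 39 : ℝ)⁻¹) ^ m := by
        gcongr
    _ = ((((Δ : ℝ) ^ 2) ^ m) ^ 11)⁻¹ := by
        have hb : (Δ : ℝ) ^ 17 * ((Δ : ℝ) ^ 39)⁻¹ = ((Δ : ℝ) ^ 22)⁻¹ := by field_simp
        rw [← mul_pow, hb, inv_pow]
        congr 1
        ring
    _ ≤ ((n : ℝ) ^ 11)⁻¹ := by gcongr

/-- Of the 24, one half pays for the chains, since (2Δ^5)^2 ≤ Δ^12, and the other half gives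
n^(-12). -/
theorem chain_count_mul_pow_le {n Δ E m : ℕ} (hΔ : 2 ≤ Δ) (hn : 0 < n) (hm : n ≤ Δ ^ (m + 1))
    (hE : 24 ≤ E) :
    ((n * (2 * Δ ^ 5) ^ (2 * m) : ℕ) : ℝ) * ((Δ ^ E : ℝ)⁻¹) ^ (m + 1) ≤ ((n : ℝ) ^ 11)⁻¹ := by
  have hΔ2 : (2 : ℝ) ≤ Δ := by exact_mod_cast hΔ
  have hΔ0 : (0 : ℝ) < Δ := by linarith
  have hΔ1 : (1 : ℝ) ≤ Δ := by linarith
  have hn0 : (0 : ℝ) < n := by exact_mod_cast hn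
  have hmR : (n : ℝ) ≤ Δ ^ (m + 1) := by exact_mod_cast hm
  have h1 : ((2 : ℝ) * Δ ^ 5) ^ (2 * m) ≤ (Δ ^ 12) ^ (m + 1) := by
    calc ((2 : ℝ) * Δ ^ 5) ^ (2 * m) ≤ ((Δ : ℝ) * (Δ : ℝ) ^ 5) ^ (2 * m) := by gcongr
      _ = ((Δ : ℝ) ^ 12) ^ m := by rw [pow_mul]; congr 1; ring
      _ ≤ ((Δ : ℝ) ^ 12) ^ (m + 1) := pow_le_pow_right₀ (one_le_pow₀ hΔ1) (Nat.le_succ m)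
  push_cast
  calc (n : ℝ) * (2 * Δ ^ 5) ^ (2 * m) * ((Δ ^ E : ℝ)⁻¹) ^ (m + 1)
      ≤ n * (Δ ^ 12) ^ (m + 1) * ((Δ ^ 24 : ℝ)⁻¹) ^ (m + 1) := by
        gcongr
    _ = n * (((Δ : ℝ) ^ (m + 1)) ^ 12)⁻¹ := by
        have hb : (Δ : ℝ) ^ 12 * ((Δ : ℝ) ^ 24)⁻¹ = ((Δ : ℝ) ^ 12)⁻¹ := by field_simp
        rw [mul_assoc, ← mul_pow, hb, inv_pow]
        congr 2
        ring
    _ ≤ n * ((n : ℝ) ^ 12)⁻¹ := by gcongr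
    _ = ((n : ℝ) ^ 11)⁻¹ := by field_simp

end Estimates

/-- Subadditivity alone is used, so `s` need not be measurable. -/
theorem one_sub_le_real {Ω : Type*} [MeasurableSpace Ω] {P : Measure Ω} [IsProbabilityMeasure P]
    {s : Set Ω} {δ : ℝ} (hδ : 0 ≤ δ) (h : P sᶜ ≤ ENNReal.ofReal δ) : 1 - δ ≤ P.real s := by
  have h1 : (1 : ℝ) ≤ P.real s + P.real sᶜ := by
    have := measureReal_union_le (μ := P) s sᶜ
    rwa [Set.union_compl_self, probReal_univ] at this
  have h2 : P.real sᶜ ≤ δ := ENNReal.toReal_le_of_le_ofReal hδ h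
  linarith

/-! ### The high-probability statement about the remaining nodes. -/

section Shattering

variable {V : Type*} [Fintype V] {G : SimpleGraph V} [DecidableRel G.Adj] {Δ : ℕ}
  {Ω : Type*} [MeasurableSpace Ω] {P : Measure Ω} [IsProbabilityMeasure P] {B : Ω → Set V}

/-- If separated sets remain with exponentially small probability, then with high probability only
few nodes remain, they form small components, and no node remains if the degree is large. -/
theorem shattering (hΔ : 2 ≤ Δ) (hdeg : ∀ v, G.degree v ≤ Δ) {α : ℝ} (hα : 0 < α) (hα1 : α < 1)
    (hP : ∀ S : Finset V, Separated G (S : Set V) → P {ω | ∀ v ∈ S, v ∈ B ω} ≤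
      ENNReal.ofReal ((Δ : ℝ) ^ (11 * ⌈100 / α⌉₊ + 39))⁻¹ ^ S.card) :
    1 - 1 / (Fintype.card V : ℝ) ^ 10 ≤ P.real {ω |
      (∀ X : (G.induce (B ω)).ConnectedComponent,
        (X.supp.ncard : ℝ) ≤ 2 * (Real.logb Δ (Fintype.card V) * (Δ : ℝ) ^ 4)) ∧
      ((B ω).ncard : ℝ) ≤ Fintype.card V / (Δ : ℝ) ^ 10 ∧
      ((Fintype.card V : ℝ) ^ (α / 4) < Δ → B ω = ∅)} := by
  set n := Fintype.card V with hn
  set M := ⌈100 / α⌉₊ with hM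
  set δ : ℝ := ((Δ : ℝ) ^ (11 * M + 39))⁻¹ with hδ
  have hΔ2 : (2 : ℝ) ≤ Δ := by exact_mod_cast hΔ
  have hΔ0 : (0 : ℝ) < Δ := by linarith
  have hΔ1 : (1 : ℝ) ≤ Δ := by linarith
  have hδ0 : 0 ≤ δ := by positivity
  have hMα : 100 / α ≤ M := Nat.le_ceil _
  refine one_sub_le_real (by positivity) ?_
  -- If n ≤ Δ^M, the exponent 11M makes the union bound over single nodes show that nothing remains.
  -- Otherwise n is so large that the third claim is vacuous.
  rcases le_or_gt n (Δ ^ M) with hnM | hnM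
  · calc _ ≤ P {ω | (B ω).Nonempty} := by
          refine measure_mono fun ω hω => ?_
          by_contra hB
          have hB' : B ω = ∅ := Set.not_nonempty_iff_eq_empty.1 hB
          refine hω ⟨fun X => ?_, ?_, fun _ => hB'⟩
          · obtain ⟨v, -⟩ := X.nonempty_supp
            exact absurd ⟨v.1, v.2⟩ hB
          · rw [hB', Set.ncard_empty]
            simp only [Nat.cast_zero]
            positivity
      _ ≤ n * ENNReal.ofReal δ := measure_nonempty_le hP
      _ ≤ ENNReal.ofReal (1 / (n : ℝ) ^ 10) := by
          rcases Nat.eq_zero_or_pos n with h0 | h0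
          · simp [h0]
          · have hn0 : (0 : ℝ) < n := by exact_mod_cast h0
            have hnM' : (n : ℝ) ≤ (Δ : ℝ) ^ M := by exact_mod_cast hnM
            rw [← ENNReal.ofReal_natCast, ← ENNReal.ofReal_mul (by positivity)]
            refine ENNReal.ofReal_le_ofReal ?_
            calc (n : ℝ) * δ ≤ n * ((n : ℝ) ^ 11)⁻¹ := by
                  rw [hδ]
                  gcongr
                  calc (n : ℝ) ^ 11 ≤ ((Δ : ℝ) ^ M) ^ 11 := by gcongr
                    _ = (Δ : ℝ) ^ (11 * M) := by rw [← pow_mul, mul_comm]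
                    _ ≤ _ := pow_le_pow_right₀ hΔ1 (by omega)
              _ = 1 / (n : ℝ) ^ 10 := by field_simp
  · have hM100 : 100 ≤ M := by
      have : (100 : ℝ) ≤ 100 / α := by rw [le_div_iff₀ hα]; linarith
      exact_mod_cast this.trans hMα
    have hn100 : Δ ^ 100 ≤ n := (Nat.pow_le_pow_right (by omega) hM100).trans hnM.le
    have hn2 : 2 ≤ n := hΔ.trans ((Nat.le_self_pow (by norm_num) Δ).trans hn100)
    have hn2' : (2 : ℝ) ≤ n := by exact_mod_cast hn2
    have hn0 : (0 : ℝ) < n := by linarith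
    have hlog : 0 < Real.logb Δ n := Real.logb_pos (by linarith) (by linarith)
    set L := Real.logb Δ n with hL
    -- This `m` is at most log_Δ n, as the component bound needs, while n ≤ Δ^(m+1), as the
    -- probability bound needs.
    obtain ⟨m, hm⟩ : ∃ m, ⌈L⌉₊ = m + 1 := ⟨⌈L⌉₊ - 1, by have := Nat.ceil_pos.2 hlog; omega⟩
    have hmL : (m : ℝ) ≤ L := by
      have := Nat.ceil_lt_add_one hlog.le
      rw [hm] at this
      push_cast at this
      linarith
    have hnm : n ≤ Δ ^ (m + 1) := by
      have h1 : (n : ℝ) ≤ (Δ : ℝ) ^ (m + 1) := by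
        calc (n : ℝ) = (Δ : ℝ) ^ L := (Real.rpow_logb hΔ0 (by linarith) hn0).symm
          _ ≤ (Δ : ℝ) ^ ((m + 1 : ℕ) : ℝ) := by
              refine Real.rpow_le_rpow_of_exponent_le hΔ1 ?_
              rw [← hm]
              exact Nat.le_ceil _
          _ = _ := Real.rpow_natCast _ _
      exact_mod_cast h1
    have hdeg3 : ¬ (n : ℝ) ^ (α / 4) < Δ := by
      rw [not_lt]
      have hnM' : (Δ : ℝ) ^ M ≤ n := by exact_mod_cast hnM.le
      have hMα' : 1 ≤ (M : ℝ) * (α / 4) := by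
        rw [div_le_iff₀ hα] at hMα
        linarith
      calc (Δ : ℝ) = (Δ : ℝ) ^ (1 : ℝ) := (Real.rpow_one _).symm
        _ ≤ (Δ : ℝ) ^ ((M : ℝ) * (α / 4)) := Real.rpow_le_rpow_of_exponent_le hΔ1 hMα'
        _ = ((Δ : ℝ) ^ M) ^ (α / 4) := by rw [Real.rpow_mul hΔ0.le, Real.rpow_natCast]
        _ ≤ (n : ℝ) ^ (α / 4) := by gcongr
    have hbad1 := measure_exists_large_component_le hΔ hdeg hP m
    have hbad2 := measure_large_le hΔ hdeg hP ((n : ℝ) / (2 * Δ ^ 14))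
    have hest1 := chain_count_mul_pow_le (E := 11 * M + 39) hΔ (by omega) hnm (by omega)
    have hest2 := choose_mul_pow_le (E := 11 * M + 39) hΔ hn100 (by omega)
    rw [← hδ] at hest1 hest2
    calc _ ≤ P ({ω | ∃ X : (G.induce (B ω)).ConnectedComponent,
            m * (2 * Δ ^ 4) < X.supp.ncard} ∪
            {ω | (n : ℝ) / (2 * Δ ^ 14) * (2 * Δ ^ 4) < (B ω).ncard}) := by
          refine measure_mono fun ω hω => ?_
          by_contra hcon
          rw [Set.mem_union, not_or] at hcon
          refine hω ⟨fun X => ?_, ?_, fun h => absurd h hdeg3⟩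
          · have h1 : X.supp.ncard ≤ m * (2 * Δ ^ 4) := by
              by_contra h
              exact hcon.1 ⟨X, not_le.1 h⟩
            calc (X.supp.ncard : ℝ) ≤ m * (2 * (Δ : ℝ) ^ 4) := by exact_mod_cast h1
              _ ≤ L * (2 * (Δ : ℝ) ^ 4) := by gcongr
              _ = _ := by ring
          · have h2 : ((B ω).ncard : ℝ) ≤ (n : ℝ) / (2 * Δ ^ 14) * (2 * Δ ^ 4) :=
              not_lt.1 hcon.2
            refine h2.trans (le_of_eq ?_)
            field_simp
      _ ≤ _ + _ := measure_union_le _ _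
      _ ≤ ENNReal.ofReal ((n : ℝ) ^ 11)⁻¹ + ENNReal.ofReal ((n : ℝ) ^ 11)⁻¹ := by
          refine add_le_add (hbad1.trans ?_) (hbad2.trans ?_)
          · rw [← ENNReal.ofReal_natCast, ← ENNReal.ofReal_pow hδ0,
              ← ENNReal.ofReal_mul (Nat.cast_nonneg _)]
            exact ENNReal.ofReal_le_ofReal hest1
          · rw [← ENNReal.ofReal_natCast, ← ENNReal.ofReal_pow hδ0,
              ← ENNReal.ofReal_mul (Nat.cast_nonneg _)]
            exact ENNReal.ofReal_le_ofReal hest2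
      _ ≤ ENNReal.ofReal (1 / (n : ℝ) ^ 10) := by
          rw [← ENNReal.ofReal_add (by positivity) (by positivity)]
          refine ENNReal.ofReal_le_ofReal ?_
          calc ((n : ℝ) ^ 11)⁻¹ + ((n : ℝ) ^ 11)⁻¹ = 2 * ((n : ℝ) ^ 11)⁻¹ := by ring
            _ ≤ n * ((n : ℝ) ^ 11)⁻¹ := by gcongr
            _ = 1 / (n : ℝ) ^ 10 := by field_simp

end Shattering

/-! ### Undecided nodes remain; frozen coins and `splice`. -/

section Decided

variable {V : Type*} {G : SimpleGraph V} {k : ℕ}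

theorem active_or_mis (R : ℕ) (θ : ℝ) {T : ℕ} (ω : Coins V T k) (t : ℕ) (v : V) :
    v ∈ (stateAfter G R θ ω t).active ∨ v ∈ (stateAfter G R θ ω t).mis ∨
      ∃ u, G.Adj v u ∧ u ∈ (stateAfter G R θ ω t).mis := by
  induction t with
  | zero => exact Or.inl (Set.mem_univ v)
  | succ t ih =>
    rw [stateAfter]
    split_ifs with ht
    · rcases ih with h | h | ⟨u, hu, h⟩
      · by_contra hcon
        simp only [not_or, not_exists, not_and] at hcon
        exact hcon.1 ⟨h, fun hj => hcon.2.1 (Or.inr hj), fun u hu hj => hcon.2.2 u hu (Or.inr hj)⟩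
      · exact Or.inr (Or.inl (Or.inl h))
      · exact Or.inr (Or.inr ⟨u, hu, Or.inl h⟩)
    · exact ih

theorem mem_remaining_of_not_decided {α : ℝ} {Δ T : ℕ} {ω : Coins V T k} {v : V}
    (h : ¬ Decided G α Δ ω v) : v ∈ remaining G α Δ ω :=
  (active_or_mis _ _ ω T v).resolve_right h

theorem mix_univ {T : ℕ} (ω η : Coins V T k) : (fun i => mix Set.univ (ω i) (η i)) = ω := by
  funext i u
  simp [mix]

theorem mix_twoHop {T : ℕ} (ω η : Coins V T k) (v : V) :
    (fun i => mix (twoHop G v) (ω i) (η i)) = splice G v ω η := rfl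

end Decided

end SparseMIS

theorem mainTheorem3 :
    ∃ K : ℝ, ∀ α : ℝ, 0 < α → α < 1 →
    ∃ C₀ : ℝ, ∀ C : ℝ, C₀ ≤ C →
    ∃ c₀ : ℝ, ∀ c : ℝ, c₀ ≤ c →
    ∀ (V : Type*) [Fintype V] (G : SimpleGraph V) [DecidableRel G.Adj] (Δ : ℕ),
      2 ≤ Δ → (∀ v, G.degree v ≤ Δ) →
      let n : ℝ := Fintype.card V
      let P : Measure (SparseMIS.Coins V (SparseMIS.numIterations c Δ)
        (SparseMIS.numRepetitions C Δ)) := volume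
      (∀ v : V,
        1 - 1 / (Δ : ℝ) ^ C ≤ P.real {ω | SparseMIS.Decided G α Δ ω v} ∧
        ∀ η : SparseMIS.Coins V (SparseMIS.numIterations c Δ) (SparseMIS.numRepetitions C Δ),
          1 - 1 / (Δ : ℝ) ^ C ≤
            P.real {ω | SparseMIS.Decided G α Δ (SparseMIS.splice G v ω η) v}) ∧
      1 - 1 / n ^ 10 ≤ P.real {ω |
        (∀ X : (G.induce (SparseMIS.remaining G α Δ ω)).ConnectedComponent,
          (X.supp.ncard : ℝ) ≤ K * (Real.logb Δ n * (Δ : ℝ) ^ 4)) ∧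
        ((SparseMIS.remaining G α Δ ω).ncard : ℝ) ≤ n / (Δ : ℝ) ^ 10 ∧
        (n ^ (α / 4) < Δ → SparseMIS.remaining G α Δ ω = ∅)} := by
  obtain ⟨C₁, -, hmain⟩ := SparseMIS.exists_volume_remaining_le
  -- The 2 comes from the ball bound 2Δ^4; the second entry of the maximum is the exponent required
  -- by `shattering`.
  refine ⟨2, fun α hα hα1 => ⟨max C₁ ((11 * ⌈100 / α⌉₊ + 39 : ℕ) : ℝ), fun C hC => ?_⟩⟩
  obtain ⟨c₀, hc₀⟩ := hmain C ((le_max_left _ _).trans hC)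
  refine ⟨c₀, ?_⟩
  intro c hc V _ G _ Δ hΔ hdeg n P
  have htail := hc₀ c hc α hα hα1 V G Δ hΔ hdeg
  have hΔ1 : (1 : ℝ) ≤ Δ := by exact_mod_cast one_le_two.trans hΔ
  have hsingle : ∀ (v : V) (A : Set V), SparseMIS.twoHop G v ⊆ A →
      ∀ η : SparseMIS.Coins V (SparseMIS.numIterations c Δ) (SparseMIS.numRepetitions C Δ),
      1 - 1 / (Δ : ℝ) ^ C ≤ P.real {ω |
        SparseMIS.Decided G α Δ (fun i => SparseMIS.mix A (ω i) (η i)) v} := by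
    intro v A hA η
    refine SparseMIS.one_sub_le_real (by positivity) ?_
    refine (measure_mono fun ω hω => ?_).trans ((htail {v} A η (by simp) (by simpa)).trans ?_)
    · intro u hu
      rw [Finset.mem_singleton.1 hu]
      exact SparseMIS.mem_remaining_of_not_decided hω
    · rw [Finset.card_singleton, pow_one, Real.rpow_neg (by linarith), one_div]
  have hη₀ : Nonempty (SparseMIS.Coins V (SparseMIS.numIterations c Δ)
      (SparseMIS.numRepetitions C Δ)) := ⟨fun _ _ => (fun _ => 0, 0)⟩
  -- Any coins will do: when no node is frozen, i.e. `A` is everything, they are never read.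
  obtain ⟨η₀⟩ := hη₀
  refine ⟨fun v => ⟨?_, fun η => ?_⟩, ?_⟩
  · simpa only [SparseMIS.mix_univ] using hsingle v Set.univ (Set.subset_univ _) η₀
  · simpa only [SparseMIS.mix_twoHop] using hsingle v _ subset_rfl η
  · refine SparseMIS.shattering hΔ hdeg hα hα1 fun S hS => ?_
    have h := htail S Set.univ η₀ hS.pairwiseDisjoint fun v _ => Set.subset_univ _
    simp only [SparseMIS.mix_univ] at h
    refine h.trans ?_
    gcongr
    rw [Real.rpow_neg (by linarith)]
    refine inv_anti₀ (by positivity) ?_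
    rw [← Real.rpow_natCast]
    exact Real.rpow_le_rpow_of_exponent_le hΔ1 ((le_max_right _ _).trans hC)
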